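/- **Setting.** Let $\Omega\subset\mathbb R^d$ be a bounded domain, $X$ and $Y$ real Hilbert spaces, $Y$ continuously embedded in $C(\bar\Omega)$ and compactly embedded in $L^2(\Omega)$, and $S:X\to Y$ linear and bounded. For $x_1,\dots,x_n\in\Omega$ ($n\ge1$) write $(a,b)_n=\frac1n\sum_i a_ib_i$ and $\|u\|_n=(\frac1n\sum_i u(x_i)^2)^{1/2}$, where a continuous function is identified with its vector of values at the $x_i$. The data are $m_i=(Sf^*)(x_i)+e_i$ with $f^*\in X$ and independent, mean-zero random variables $e_i$ that are sub-Gaussian with parameter $\sigma>0$, i.e. $\mathbb E[e^{t(e_i-\mathbb E e_i)}]\le e^{\sigma^2t^2/2}$ for all $t\in\mathbb R$. Put $\rho_0=\|f^*\|_X+\sigma n^{-1/2}$. Let $V_h\subset X$, $Y_h\subset Y$ be finite-dimensional subspaces, $N_h=\dim V_h$, $S_h:X\to Y_h$ linear, $\lambda_n>0$, $e(h)\ge0$, and let $f_h\in V_h$ be the solution of $$\lambda_n(f_h,v_h)_X+(S_hf_h,S_hv_h)_n=(m,S_hv_h)_n\qquad\forall v_h\in V_h .$$ **Assumptions.** Fix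 a number $\gamma<2$ and positive constants $C_2,C_3,C_4,C_5$, and assume: * (Assumption 2) the covering numbers of the unit ball $SY$ of $Y$ satisfy $\log N(\varepsilon,SY,\|\cdot\|_{L^\infty(\Omega)})\le C_2\varepsilon^{-\gamma}$ for all $\varepsilon>0$; * (Assumption 3) for every $f\in X$, $\|Sf-S_hf\|_n^2\le C_3e(h)\|f\|_X^2$, and there is $v_h\in V_h$ with $\lambda_n\|f-v_h\|_X^2+\|S_hf-S_hv_h\|_n^2\le C_3(\lambda_n+e(h))\|f\|_X^2$; * $e(h)\le C_4\lambda_n$, $\;N_he(h)\le C_4\lambda_n^{1-\gamma/2}$, and $\;\sigma n^{-1/2}\rho_0^{-1}\le C_5\,\lambda_n^{1/2+\gamma/4}$. **Theorem.** Let also $1<\alpha\le\beta$, $C_1>0$ and $c_1>0$ be given. There is a constant $C>0$ that depends only on $\Omega$, $X$, $Y$, $S$ and the fixed constants $\gamma,C_2,\dots,C_5,\alpha,\beta,C_1,c_1$ (not on $n$, the $x_i$, the noise and $\sigma$, $f^*$, $\lambda_n$, $V_h,Y_h,S_h$, $e(h)$), such that for all $z>0$ $$\mathbb P\big(\|S_hf_h-Sf^*\|_n\ge\lambda_n^{1/2}\rho_0z\big)\le2e^{-Cz^2},\qquad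 \mathbb P\big(\|f_h\|_X\ge\rho_0z\big)\le2e^{-Cz^2}.$$ Moreover, assume in addition that * $X$ has an orthonormal basis $\{\phi_k\}_{k\ge1}$ of eigenfunctions of $(\psi,v)_X=\eta\,(S\psi,Sv)_{L^2(\Omega)}$ $(\forall v\in X)$, with eigenvalues $0<\eta_1\le\eta_2\le\cdots$; * (Assumption 1) $\eta_k\ge c_1k^\alpha$ for $k=1,\dots,n$, and for all $u\in Y$ both $\|u\|_{L^2(\Omega)}^2\le C_1(\|u\|_n^2+n^{-\beta}\|u\|_Y^2)$ and $\|u\|_n^2\le C_1(\|u\|_{L^2(\Omega)}^2+n^{-\beta}\|u\|_Y^2)$; * $n^{-\beta}\le\lambda_n$. Let $Z=\{g\in X:\ \|g\|_Z^2:=\sum_k\eta_k^{1/2}(g,\phi_k)_X^2<\infty\}$ and $\|v\|_{Z'}=\sup_{0\ne g\in Z}|(v,g)_X|/\|g\|_Z$ for $v\in X$. Then, with the same $C$, for all $z>0$ $$\mathbb P\big(\|f_h-f^*\|_{Z'}\ge\lambda_n^{1/4}\rho_0z\big)\le2e^{-Cz^2}.$$ -/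

import Mathlib

open MeasureTheory ProbabilityTheory Filter Topology
open scoped NNReal ENNReal BoundedContinuousFunction

noncomputable section

namespace InverseSource

/-- `ℝᵈ` with the Euclidean norm. -/
abbrev Space (d : ℕ) : Type := EuclideanSpace ℝ (Fin d)

section Functions

variable {d : ℕ} {Ω : Set (Space d)} {X Y : Type*}
  [NormedAddCommGroup X] [InnerProductSpace ℝ X]
  [NormedAddCommGroup Y] [InnerProductSpace ℝ Y]

/-- The value at a point `p ∈ Ω` of the continuous function on the closure of `Ω` that the
element `u` of `Y` stands for (`ι` is the embedding of `Y` into `C(closure Ω)`, with the sup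
norm). -/
def value (ι : Y →L[ℝ] (closure Ω →ᵇ ℝ)) (u : Y) (p : Ω) : ℝ :=
  ι u ⟨p, subset_closure p.2⟩

/-- Lebesgue measure on `Ω`. -/
def volOn (Ω : Set (Space d)) : Measure Ω := Measure.comap Subtype.val volume

/-- `Y` is continuously embedded in `C(closure Ω)` by `ι` (continuity is part of the type of `ι`)
and compactly embedded in `L²(Ω)`: every sequence in the unit ball has a subsequence that
converges in `L²(Ω)`. -/
structure IsObservationEmbedding (ι : Y →L[ℝ] (closure Ω →ᵇ ℝ)) : Prop where
  injective : Function.Injective ι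
  compact_L2 : ∀ u : ℕ → Y, (∀ k, ‖u k‖ ≤ 1) →
    ∃ w : Ω → ℝ, MemLp w 2 (volOn Ω) ∧ ∃ s : ℕ → ℕ, StrictMono s ∧
      Tendsto (fun k => eLpNorm (fun p => value ι (u (s k)) p - w p) 2 (volOn Ω)) atTop (𝓝 0)

/-- The inner product of `L²(Ω)` on `Y`. -/
def l2Inner (ι : Y →L[ℝ] (closure Ω →ᵇ ℝ)) (u v : Y) : ℝ :=
  ∫ p, value ι u p * value ι v p ∂(volOn Ω)

/-- The vector of the values of `u` at the points `x₁, …, xₙ`. -/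
def sample (ι : Y →L[ℝ] (closure Ω →ᵇ ℝ)) {n : ℕ} (x : Fin n → Ω) (u : Y) : Fin n → ℝ :=
  fun i => value ι u (x i)

/-- `(a, b)ₙ = n⁻¹ ∑ aᵢ bᵢ`. -/
def empInner {n : ℕ} (a b : Fin n → ℝ) : ℝ := (1 / (n : ℝ)) * ∑ i, a i * b i

/-- The semi-norm `‖u‖ₙ = (n⁻¹ ∑ u(xᵢ)²)^{1/2}`, as a function of the vector of values. -/
def empNorm {n : ℕ} (a : Fin n → ℝ) : ℝ := Real.sqrt ((∑ i, a i ^ 2) / (n : ℝ))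

/-- The covering entropy of the unit ball of `Y` in the sup norm:
`log N(ε, SY, ‖·‖_{L^∞(Ω)}) ≤ C ε^{-γ}` for all `ε > 0` (`N = ∞` is excluded by this). -/
def CoveringEntropyBound (ι : Y →L[ℝ] (closure Ω →ᵇ ℝ)) (γ C : ℝ) : Prop :=
  ∀ ε : ℝ≥0, 0 < ε →
    ENNReal.log ((Metric.coveringNumber ε (ι '' Metric.closedBall (0 : Y) 1) : ℕ∞) : ℝ≥0∞)
      ≤ ((C * (ε : ℝ) ^ (-γ) : ℝ) : EReal)

/-- The two-sided comparison of the empirical semi-norm and the `L²(Ω)` norm on `Y`. -/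
def NormComparison (ι : Y →L[ℝ] (closure Ω →ᵇ ℝ)) {n : ℕ} (x : Fin n → Ω) (β C : ℝ) : Prop :=
  ∀ u : Y,
    l2Inner ι u u ≤ C * (empNorm (sample ι x u) ^ 2 + (n : ℝ) ^ (-β) * ‖u‖ ^ 2) ∧
    empNorm (sample ι x u) ^ 2 ≤ C * (l2Inner ι u u + (n : ℝ) ^ (-β) * ‖u‖ ^ 2)

/-- `φ₀, φ₁, …` is an orthonormal basis of `X` that consists of eigenfunctions of
`(ψ, v)_X = η (S ψ, S v)_{L²(Ω)}` for all `v ∈ X`, with the eigenvalues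
`0 < η₀ ≤ η₁ ≤ ⋯`, counted with multiplicity. -/
structure IsEigenBasis (ι : Y →L[ℝ] (closure Ω →ᵇ ℝ)) (S : X →L[ℝ] Y)
    (η : ℕ → ℝ) (φ : HilbertBasis ℕ ℝ X) : Prop where
  pos : ∀ k, 0 < η k
  mono : Monotone η
  eigen : ∀ k v, inner ℝ (φ k) v = η k * l2Inner ι (S (φ k)) (S v)

/-- The space `Z` of all `g ∈ X` with `∑ η_k^{1/2} g_k² < ∞`, where `g_k = (g, φ_k)_X`. -/
def spaceZ (η : ℕ → ℝ) (φ : HilbertBasis ℕ ℝ X) : Set X :=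
  {g | Summable fun k => (η k) ^ (1 / 2 : ℝ) * (inner ℝ g (φ k)) ^ 2}

/-- The norm of `Z`: `‖g‖_Z² = ∑ η_k^{1/2} g_k²`. -/
def normZ (η : ℕ → ℝ) (φ : HilbertBasis ℕ ℝ X) (g : X) : ℝ :=
  Real.sqrt (∑' k, (η k) ^ (1 / 2 : ℝ) * (inner ℝ g (φ k)) ^ 2)

/-- The norm of `v ∈ X` as an element of the dual space `Z'` (pivot space `X`):
the supremum of `|(v, g)_X| / ‖g‖_Z` over all nonzero `g ∈ Z`. -/
def dualNormZ (η : ℕ → ℝ) (φ : HilbertBasis ℕ ℝ X) (v : X) : ℝ≥0∞ :=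
  ⨆ (g : X) (_ : g ∈ spaceZ η φ) (_ : g ≠ 0), ENNReal.ofReal (|inner ℝ v g| / normZ η φ g)

end Functions

/-- Independent, centred, sub-Gaussian noise with parameter `σ`:
`E[exp (t (eᵢ - E eᵢ))] ≤ exp (σ² t² / 2)` for all real `t`. -/
structure IsSubGaussianNoise {𝔛 : Type*} [MeasurableSpace 𝔛] (P : Measure 𝔛) (σ : ℝ) {n : ℕ}
    (e : Fin n → 𝔛 → ℝ) : Prop where
  measurable : ∀ i, Measurable (e i)
  indep : iIndepFun e P
  mean_zero : ∀ i, ∫ ω, e i ω ∂P = 0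
  subGaussian : ∀ i, HasSubgaussianMGF (fun ω => e i ω - ∫ ω', e i ω' ∂P) (σ ^ 2).toNNReal P

/-- Finite-dimensional subspaces `V_h ⊆ X`, `Y_h ⊆ Y` and a discrete operator
`S_h : X → Y_h ⊆ Y`, linear. -/
structure Discretization (X Y : Type*) [NormedAddCommGroup X] [InnerProductSpace ℝ X]
    [NormedAddCommGroup Y] [InnerProductSpace ℝ Y] where
  Vh : Submodule ℝ X
  Yh : Submodule ℝ Y
  Sh : X →ₗ[ℝ] Y
  finite_Vh : FiniteDimensional ℝ Vh
  finite_Yh : FiniteDimensional ℝ Yh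
  range_Sh : ∀ f, Sh f ∈ Yh

namespace Discretization

variable {d : ℕ} {Ω : Set (Space d)} {X Y : Type*}
  [NormedAddCommGroup X] [InnerProductSpace ℝ X]
  [NormedAddCommGroup Y] [InnerProductSpace ℝ Y]

/-- `N_h = dim V_h`. -/
def dimVh (D : Discretization X Y) : ℕ := Module.finrank ℝ D.Vh

/-- The approximation properties of the discrete operator and of `V_h`, with error `eh = e(h)`,
regularization parameter `lam` and constant `C`. -/
structure Approximates (D : Discretization X Y) (ι : Y →L[ℝ] (closure Ω →ᵇ ℝ)) (S : X →L[ℝ] Y)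
    {n : ℕ} (x : Fin n → Ω) (lam eh C : ℝ) : Prop where
  operator_error : ∀ f : X, empNorm (sample ι x (S f - D.Sh f)) ^ 2 ≤ C * eh * ‖f‖ ^ 2
  space_error : ∀ f : X, ∃ v ∈ D.Vh,
    lam * ‖f - v‖ ^ 2 + empNorm (sample ι x (D.Sh f - D.Sh v)) ^ 2 ≤ C * (lam + eh) * ‖f‖ ^ 2

/-- `f ∈ V_h` solves the discrete problem with the data vector `m`:
`lam (f, v)_X + (S_h f, S_h v)ₙ = (m, S_h v)ₙ` for all `v ∈ V_h`. -/
def IsSolution (D : Discretization X Y) (ι : Y →L[ℝ] (closure Ω →ᵇ ℝ))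
    {n : ℕ} (x : Fin n → Ω) (lam : ℝ) (m : Fin n → ℝ) (f : X) : Prop :=
  f ∈ D.Vh ∧ ∀ v ∈ D.Vh,
    lam * inner ℝ f v + empInner (sample ι x (D.Sh f)) (sample ι x (D.Sh v))
      = empInner m (sample ι x (D.Sh v))

end Discretization

end InverseSource

end

open InverseSource

/-! Testing the discrete equation with `g = f_h - v`, where `v ∈ V_h` is the approximant of `f*`
given by the space error, bounds the energy `λ‖g‖² + ‖S_h g‖ₙ²` by approximation terms of order
`λ^{1/2} ρ₀` times the energy norm, plus the noise term `(e, S_h g)ₙ`. Nothing controls `S_h g` in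
`Y`, so the noise term is split as `(e, S g)ₙ - (e, (S - S_h) g)ₙ`.

The first piece is handled by chaining over sup-norm nets of the unit ball of `Y`
(`exists_maximal_inequality`): outside an event of Gaussian probability, `|(e, u)ₙ| ≤ K σ n^{-1/2} z
‖u‖ₙ^{1-γ/2} ‖u‖_Y^{γ/2}` simultaneously for all `u`. The second lives in a space of dimension at
most `N_h`, where an exponential-square moment costs only a factor `√N_h`
(`IsSubGaussianNoise.measure_exists_lt_abs_empInner_le`). The conditions on `λ` make both pieces
`O(λ^{1/2} ρ₀ z)` times the energy norm. The rest of the error analysis is deterministic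
(`exists_error_bound`).

The `Z'` bound is an interpolation, `‖v‖_{Z'}² ≤ ‖v‖_X ‖S v‖_{L²}` (`IsEigenBasis.dualNormZ_le`),
with the `L²` norm compared to the empirical one. Every event of the theorem is included in the
exceptional noise event, so the measurability of `f_h` plays no role. -/

namespace InverseSource

/-! ### The empirical semi-norm as a scaled Euclidean norm. -/

section EmpiricalNorm

variable {n : ℕ}

theorem empNorm_eq_norm (a : Fin n → ℝ) :
    empNorm a = ‖WithLp.toLp 2 a‖ / √(n : ℝ) := by
  rw [empNorm, Real.sqrt_div (Finset.sum_nonneg fun i _ => sq_nonneg _), EuclideanSpace.norm_eq]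
  simp

theorem empInner_eq_inner (a b : Fin n → ℝ) :
    empInner a b = inner ℝ (WithLp.toLp 2 b) (WithLp.toLp 2 a) / (n : ℝ) := by
  rw [empInner, EuclideanSpace.inner_eq_star_dotProduct]
  simp [dotProduct, div_eq_inv_mul]

theorem empNorm_nonneg (a : Fin n → ℝ) : 0 ≤ empNorm a := Real.sqrt_nonneg _

theorem empNorm_add_le (a b : Fin n → ℝ) : empNorm (a + b) ≤ empNorm a + empNorm b := by
  simp only [empNorm_eq_norm, ← add_div, WithLp.toLp_add]
  gcongr
  exact norm_add_le _ _

theorem empNorm_smul (c : ℝ) (a : Fin n → ℝ) : empNorm (c • a) = |c| * empNorm a := by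
  simp only [empNorm_eq_norm, WithLp.toLp_smul, norm_smul, Real.norm_eq_abs, mul_div_assoc]

theorem empNorm_neg (a : Fin n → ℝ) : empNorm (-a) = empNorm a := by
  simp [empNorm]

theorem abs_empInner_le (a b : Fin n → ℝ) : |empInner a b| ≤ empNorm a * empNorm b := by
  rw [empInner_eq_inner, empNorm_eq_norm, empNorm_eq_norm, div_mul_div_comm,
    Real.mul_self_sqrt (Nat.cast_nonneg n), abs_div, Nat.abs_cast, mul_comm ‖_‖]
  gcongr
  exact abs_real_inner_le_norm _ _

theorem empInner_add_left (a b c : Fin n → ℝ) :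
    empInner (a + b) c = empInner a c + empInner b c := by
  simp [empInner, add_mul, Finset.sum_add_distrib, mul_add]

theorem empInner_sub_left (a b c : Fin n → ℝ) :
    empInner (a - b) c = empInner a c - empInner b c := by
  simp [empInner, sub_mul, Finset.sum_sub_distrib, mul_sub]

theorem empInner_add_right (a b c : Fin n → ℝ) :
    empInner a (b + c) = empInner a b + empInner a c := by
  simp [empInner, mul_add, Finset.sum_add_distrib]

theorem empInner_sub_right (a b c : Fin n → ℝ) :
    empInner a (b - c) = empInner a b - empInner a c := by
  simp [empInner, mul_sub, Finset.sum_sub_distrib]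

theorem empInner_smul_right (t : ℝ) (a b : Fin n → ℝ) :
    empInner a (t • b) = t * empInner a b := by
  simp only [empInner, Pi.smul_apply, smul_eq_mul, mul_left_comm _ t, ← Finset.mul_sum]

theorem empInner_self (a : Fin n → ℝ) : empInner a a = empNorm a ^ 2 := by
  rw [empNorm, Real.sq_sqrt (by positivity), empInner, one_div, div_eq_inv_mul]
  simp [sq]

theorem empNorm_le_of_forall_abs_le (a : Fin n → ℝ) {M : ℝ} (hM : 0 ≤ M) (h : ∀ i, |a i| ≤ M) :
    empNorm a ≤ M := by
  rw [empNorm, Real.sqrt_le_left hM]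
  refine div_le_of_le_mul₀ (Nat.cast_nonneg n) (by positivity) ?_
  calc ∑ i, a i ^ 2 ≤ ∑ _i : Fin n, M ^ 2 :=
        Finset.sum_le_sum fun i _ => sq_le_sq.2 ((h i).trans (le_abs_self M))
    _ = M ^ 2 * n := by simp [mul_comm]

end EmpiricalNorm

/-! ### Sub-Gaussian tails: a fixed vector, and uniformly over a finite-dimensional space. -/

section Noise

variable {𝔛 : Type*} [MeasurableSpace 𝔛] {P : Measure 𝔛}
  {σ : ℝ} {n : ℕ} {e : Fin n → 𝔛 → ℝ}

theorem measure_lt_abs_le_of_hasSubgaussianMGF [IsProbabilityMeasure P] {X : 𝔛 → ℝ} {c : ℝ≥0} (h : HasSubgaussianMGF X c P)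
    {t : ℝ} (ht : 0 ≤ t) :
    P {ω | t < |X ω|} ≤ ENNReal.ofReal (2 * Real.exp (-t ^ 2 / (2 * c))) := by
  have key : ∀ {Z : 𝔛 → ℝ}, HasSubgaussianMGF Z c P →
      P {ω | t ≤ Z ω} ≤ ENNReal.ofReal (Real.exp (-t ^ 2 / (2 * c))) := fun hZ => by
    rw [ENNReal.le_ofReal_iff_toReal_le (measure_ne_top _ _) (Real.exp_nonneg _)]
    exact hZ.measure_ge_le ht
  calc P {ω | t < |X ω|} ≤ P ({ω | t ≤ X ω} ∪ {ω | t ≤ (-X) ω}) := by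
        refine measure_mono fun ω (hω : t < |X ω|) => ?_
        rcases lt_abs.1 hω with h | h
        · exact Or.inl h.le
        · exact Or.inr h.le
    _ ≤ _ := (measure_union_le _ _).trans (add_le_add (key h) (key h.neg))
    _ = _ := by rw [← ENNReal.ofReal_add (Real.exp_nonneg _) (Real.exp_nonneg _), ← two_mul]

theorem IsSubGaussianNoise.hasSubgaussianMGF_sum (he : IsSubGaussianNoise P σ e) (a : Fin n → ℝ) :
    HasSubgaussianMGF (fun ω => ∑ i, e i ω * a i) (σ ^ 2 * ∑ i, a i ^ 2).toNNReal P := by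
  have h1 : ∀ i, HasSubgaussianMGF (fun ω => a i * e i ω)
      ((a i ^ 2).toNNReal * (σ ^ 2).toNNReal) P := fun i => by
    have := he.subGaussian i
    simp only [he.mean_zero i, sub_zero] at this
    rw [Real.toNNReal_of_nonneg (sq_nonneg (a i))]
    exact this.const_mul (a i)
  have hind : iIndepFun (fun i ω => a i * e i ω) P :=
    he.indep.comp (fun i y => a i * y) fun i => measurable_const_mul (a i)
  have h2 := HasSubgaussianMGF.sum_of_iIndepFun hind (s := Finset.univ) fun i _ => h1 i
  convert h2 using 1
  · ext ω
    exact Finset.sum_congr rfl fun i _ => mul_comm _ _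
  · apply NNReal.coe_injective
    rw [Real.coe_toNNReal _ (by positivity)]
    simp [Finset.mul_sum, sq_nonneg, mul_comm]

theorem rpow_neg_half_eq (n : ℕ) : (n : ℝ) ^ (-1 / 2 : ℝ) = (√(n : ℝ))⁻¹ := by
  rw [neg_div, Real.rpow_neg (Nat.cast_nonneg n), Real.sqrt_eq_rpow]

/-- The form `(e, a)ₙ` is sub-Gaussian with variance proxy `σ² ‖a‖ₙ² / n`. The strict inequality in
the event makes it empty when `‖a‖ₙ = 0`. -/
theorem IsSubGaussianNoise.measure_lt_abs_empInner_le [IsProbabilityMeasure P] (hn : 0 < n) (hσ : 0 < σ)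
    (he : IsSubGaussianNoise P σ e) (a : Fin n → ℝ) {t : ℝ} (ht : 0 ≤ t) :
    P {ω | σ * (n : ℝ) ^ (-1 / 2 : ℝ) * t * empNorm a < |empInner (fun i => e i ω) a|}
      ≤ ENNReal.ofReal (2 * Real.exp (-t ^ 2 / 2)) := by
  have hn' : (0 : ℝ) < n := Nat.cast_pos.2 hn
  set A : ℝ := ∑ i, a i ^ 2 with hA
  have hA0 : 0 ≤ A := by positivity
  rcases hA0.eq_or_lt with h0 | hpos
  · have ha : empNorm a = 0 := by simp [empNorm, ← hA, ← h0]
    have : {ω | σ * (n : ℝ) ^ (-1 / 2 : ℝ) * t * empNorm a < |empInner (fun i => e i ω) a|} = ∅ := by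
      ext ω
      have := abs_empInner_le (fun i => e i ω) a
      simp only [ha, mul_zero] at this ⊢
      simpa using this
    simp [this]
  · refine le_trans (measure_mono ?_) ((measure_lt_abs_le_of_hasSubgaussianMGF
      (he.hasSubgaussianMGF_sum a) (t := σ * t * √A) (by positivity)).trans (le_of_eq ?_))
    · intro ω hω
      simp only [Set.mem_ofPred_eq, empInner, one_div, abs_mul, abs_inv, Nat.abs_cast] at hω ⊢
      rw [rpow_neg_half_eq n, empNorm, Real.sqrt_div hA0] at hω
      have h3 : σ * (√(n : ℝ))⁻¹ * t * (√A / √(n : ℝ)) = (n : ℝ)⁻¹ * (σ * t * √A) := by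
        nth_rw 3 [← Real.mul_self_sqrt hn'.le]
        rw [mul_inv]; ring
      rw [h3] at hω
      exact lt_of_mul_lt_mul_left hω (by positivity)
    · rw [Real.coe_toNNReal _ (by positivity)]
      congr 3
      rw [mul_pow, mul_pow, Real.sq_sqrt hA0, ← hA]
      field_simp

theorem IsSubGaussianNoise.measurable_sum (he : IsSubGaussianNoise P σ e) (a : Fin n → ℝ) :
    Measurable fun ω => ∑ i, e i ω * a i :=
  Finset.measurable_sum _ fun i _ => (he.measurable i).mul_const _

/-- A bound for `E exp (X² / (8 c))` when `X` is sub-Gaussian with variance proxy `c`. -/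
noncomputable def expSqConst : ℝ≥0∞ :=
  1 + ∑' k : ℕ, ENNReal.ofReal (Real.exp (((k : ℝ) + 1) ^ 2 / 8)) *
    ENNReal.ofReal (2 * Real.exp (-(k : ℝ) ^ 2 / 2))

theorem expSqConst_ne_top : expSqConst ≠ ⊤ := by
  refine ENNReal.add_ne_top.2 ⟨ENNReal.one_ne_top, ne_top_of_le_ne_top ?_
    (ENNReal.tsum_le_tsum (g := fun k : ℕ =>
      ENNReal.ofReal (2 * Real.exp (1 / 4) * Real.exp (-(1 / 4)) ^ k)) fun k => ?_)⟩
  · refine Summable.tsum_ofReal_ne_top (Summable.mul_left _ ?_)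
    exact summable_geometric_of_lt_one (Real.exp_nonneg _) (by simp)
  · rw [← ENNReal.ofReal_mul (Real.exp_nonneg _)]
    refine ENNReal.ofReal_le_ofReal ?_
    rw [mul_left_comm, mul_assoc, ← Real.exp_nat_mul, ← Real.exp_add, ← Real.exp_add]
    -- The growth `(k+1)²/8` loses to the decay `k²/2`; for integers `k ≤ k²` turns the difference
    -- into a linear exponent, hence a geometric series.
    have : (k : ℝ) ≤ k ^ 2 := by exact_mod_cast Nat.le_self_pow two_ne_zero k
    have := Real.exp_le_exp.2 (show ((k : ℝ) + 1) ^ 2 / 8 + -(k : ℝ) ^ 2 / 2 ≤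
      1 / 4 + k * -(1 / 4) by nlinarith [sq_nonneg ((k : ℝ) - 1)])
    linarith

/-- Cut `|X|` into shells `(ck, c(k+1)]`, bound the integrand by its value at the outer radius and
the mass of a shell by the tail beyond its inner radius. The bound does not depend on `c`. -/
theorem lintegral_exp_sq_le_expSqConst [IsProbabilityMeasure P] {X : 𝔛 → ℝ} (hX : Measurable X) {c : ℝ} (hc : 0 < c)
    (h : HasSubgaussianMGF X (c ^ 2).toNNReal P) :
    ∫⁻ ω, ENNReal.ofReal (Real.exp (X ω ^ 2 / (8 * c ^ 2))) ∂P ≤ expSqConst := by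
  have hm : ∀ k : ℕ, MeasurableSet {ω | c * k < |X ω|} := fun k =>
    measurableSet_lt measurable_const hX.abs
  have hpt : ∀ ω, ENNReal.ofReal (Real.exp (X ω ^ 2 / (8 * c ^ 2))) ≤
      1 + ∑' k : ℕ, {ω | c * k < |X ω|}.indicator
        (fun _ => ENNReal.ofReal (Real.exp (((k : ℝ) + 1) ^ 2 / 8))) ω := fun ω => by
    rcases (abs_nonneg (X ω)).eq_or_lt with h0 | h0
    · simp [abs_eq_zero.1 h0.symm]
    · obtain ⟨k, hk⟩ : ∃ k : ℕ, ⌈|X ω| / c⌉₊ = k + 1 :=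
        Nat.exists_eq_succ_of_ne_zero (Nat.ceil_pos.2 (by positivity)).ne'
      have h1 : c * k < |X ω| := by
        rw [mul_comm, ← lt_div_iff₀ hc, ← Nat.lt_ceil]; omega
      have h2 : |X ω| ≤ c * (k + 1) := by
        have := Nat.le_ceil (|X ω| / c)
        rw [hk, div_le_iff₀ hc] at this
        push_cast at this; linarith
      refine le_trans ?_ (le_add_left (ENNReal.le_tsum k))
      rw [Set.indicator_of_mem (by exact h1)]
      refine ENNReal.ofReal_le_ofReal (Real.exp_le_exp.2 ?_)
      rw [div_le_div_iff₀ (by positivity) (by norm_num), ← sq_abs]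
      nlinarith [pow_le_pow_left₀ (abs_nonneg _) h2 2]
  refine (lintegral_mono hpt).trans ?_
  rw [lintegral_add_left measurable_const, lintegral_tsum fun k =>
    (measurable_const.indicator (hm k)).aemeasurable]
  simp only [lintegral_const, measure_univ, mul_one, lintegral_indicator_const (hm _)]
  refine add_le_add_right (ENNReal.tsum_le_tsum fun k => ?_) 1
  gcongr
  refine (measure_lt_abs_le_of_hasSubgaussianMGF h (by positivity)).trans (le_of_eq ?_)
  rw [Real.coe_toNNReal _ (by positivity)]
  congr 3
  field_simp

/-- Cauchy–Schwarz in the coordinates of `W`: only the projection of `y` onto `W` matters. -/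
theorem abs_inner_le_of_mem {E : Type*} [NormedAddCommGroup E] [InnerProductSpace ℝ E]
    {W : Submodule ℝ E} {m : ℕ} (b : OrthonormalBasis (Fin m) ℝ W) {w : E} (hw : w ∈ W) (y : E) :
    |inner ℝ w y| ≤ ‖w‖ * √(∑ j, inner ℝ (b j : E) y ^ 2) := by
  have h1 : (∑ j, inner ℝ (b j : E) w • (b j : E)) = w := by
    have := congrArg (Subtype.val : W → E) (b.sum_repr' ⟨w, hw⟩)
    simpa using this
  have h2 : ∑ j, inner ℝ (b j : E) w ^ 2 = ‖w‖ ^ 2 := by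
    have := b.sum_sq_norm_inner_right ⟨w, hw⟩
    simpa using this
  have h3 : inner ℝ w y = ∑ j, inner ℝ (b j : E) w * inner ℝ (b j : E) y := by
    conv_lhs => rw [← h1, sum_inner]
    simp [real_inner_smul_left]
  rw [h3]
  refine abs_le_of_sq_le_sq ?_ (by positivity)
  rw [mul_pow, Real.sq_sqrt (by positivity), ← h2]
  exact Finset.sum_mul_sq_le_sq_mul_sq _ _ _

/-- The event forces the squared projection `∑ X_j²` of the noise onto `W` above `σ² t² N`. By
Jensen, the exponential of the average of `X_j² / (8σ²)` is at most the average of the exponentials,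
whose mean is bounded independently of the dimension; Markov concludes. The coordinates `X_j` need
not be independent. -/
theorem IsSubGaussianNoise.measure_exists_lt_abs_empInner_le [IsProbabilityMeasure P] (hn : 0 < n) (hσ : 0 < σ)
    (he : IsSubGaussianNoise P σ e) (W : Submodule ℝ (EuclideanSpace ℝ (Fin n))) {N : ℕ}
    (hN : Module.finrank ℝ W ≤ N) {t : ℝ} (ht : 0 ≤ t) :
    P {ω | ∃ w ∈ W, σ * (n : ℝ) ^ (-1 / 2 : ℝ) * t * √(N : ℝ) * empNorm (n := n) w
        < |empInner (fun i => e i ω) w|}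
      ≤ expSqConst * ENNReal.ofReal (Real.exp (-t ^ 2 / 8)) := by
  have hn' : (0 : ℝ) < n := Nat.cast_pos.2 hn
  set m := Module.finrank ℝ W with hm
  let b : OrthonormalBasis (Fin m) ℝ W := stdOrthonormalBasis ℝ W
  let X : Fin m → 𝔛 → ℝ := fun j ω => ∑ i, e i ω * (b j : EuclideanSpace ℝ (Fin n)) i
  have hXm : ∀ j, Measurable (X j) := fun j => he.measurable_sum _
  have hXg : ∀ j, HasSubgaussianMGF (X j) (σ ^ 2).toNNReal P := fun j => by
    have h := he.hasSubgaussianMGF_sum (b j : EuclideanSpace ℝ (Fin n))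
    have h1 : ∑ i, (b j : EuclideanSpace ℝ (Fin n)) i ^ 2 = 1 := by
      have h2 : ‖(b j : EuclideanSpace ℝ (Fin n))‖ = 1 := b.norm_eq_one j
      have h3 := EuclideanSpace.real_norm_sq_eq (b j : EuclideanSpace ℝ (Fin n))
      rw [← h3, h2, one_pow]
    rwa [h1, mul_one] at h
  have hXi : ∀ j ω, inner ℝ (b j : EuclideanSpace ℝ (Fin n)) (WithLp.toLp 2 fun i => e i ω)
      = X j ω := fun j ω => by
    rw [EuclideanSpace.inner_eq_star_dotProduct]
    simp [dotProduct, X]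
  have hev : ∀ ω, (∃ w ∈ W, σ * (n : ℝ) ^ (-1 / 2 : ℝ) * t * √(N : ℝ) * empNorm (n := n) w
        < |empInner (fun i => e i ω) w|) → σ ^ 2 * t ^ 2 * N < ∑ j, X j ω ^ 2 := by
    rintro ω ⟨w, hw, hlt⟩
    have h1 := abs_inner_le_of_mem b hw (WithLp.toLp 2 fun i => e i ω)
    simp only [hXi] at h1
    rw [empInner_eq_inner, empNorm_eq_norm, rpow_neg_half_eq, abs_div, Nat.abs_cast,
      lt_div_iff₀ hn'] at hlt
    have h3 : σ * (√(n : ℝ))⁻¹ * t * √(N : ℝ) * (‖w‖ / √(n : ℝ)) * n = ‖w‖ * (σ * t * √(N : ℝ)) := by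
      have h4 : √(n : ℝ) ≠ 0 := (Real.sqrt_pos.2 hn').ne'
      field_simp
      rw [Real.sq_sqrt hn'.le]
      ring
    have h4 : ‖w‖ * (σ * t * √(N : ℝ)) < ‖w‖ * √(∑ j, X j ω ^ 2) :=
      (h3.symm.trans_lt hlt).trans_le h1
    have h5 := lt_of_mul_lt_mul_left h4 (norm_nonneg _)
    rw [Real.lt_sqrt (by positivity)] at h5
    rwa [mul_pow, mul_pow, Real.sq_sqrt (Nat.cast_nonneg _)] at h5
  -- Averaging over coordinates needs `m > 0`; for `m = 0` the strict inequality rules the event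
  -- out.
  rcases Nat.eq_zero_or_pos m with h0 | hpos
  · refine le_of_eq_of_le ?_ zero_le
    refine measure_mono_null (t := ∅) (fun ω hω => ?_) measure_empty
    have hlt := hev ω hω
    have : IsEmpty (Fin m) := by rw [h0]; infer_instance
    rw [Finset.univ_eq_empty, Finset.sum_empty] at hlt
    exact absurd hlt (not_lt.2 (by positivity))
  · have hm' : (0 : ℝ) < m := Nat.cast_pos.2 hpos
    let F : 𝔛 → ℝ≥0∞ := fun ω =>
      ∑ j, ENNReal.ofReal (m : ℝ)⁻¹ * ENNReal.ofReal (Real.exp (X j ω ^ 2 / (8 * σ ^ 2)))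
    have hjm : ∀ j, Measurable fun ω => ENNReal.ofReal (Real.exp (X j ω ^ 2 / (8 * σ ^ 2))) :=
      fun j => by have := hXm j; fun_prop
    have hFm : Measurable F := Finset.measurable_sum _ fun j _ => (hjm j).const_mul _
    have hFi : ∫⁻ ω, F ω ∂P ≤ expSqConst := by
      simp only [F]
      rw [lintegral_finsetSum _ fun j _ => (hjm j).const_mul _]
      simp only [lintegral_const_mul _ (hjm _)]
      calc _ ≤ ∑ _j : Fin m, ENNReal.ofReal (m : ℝ)⁻¹ * expSqConst :=
            Finset.sum_le_sum fun j _ => by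
              gcongr; exact lintegral_exp_sq_le_expSqConst (hXm j) hσ (hXg j)
        _ = expSqConst := by
            rw [Finset.sum_const, Finset.card_univ, Fintype.card_fin, nsmul_eq_mul, ← mul_assoc,
              ← ENNReal.ofReal_natCast, ← ENNReal.ofReal_mul hm'.le, mul_inv_cancel₀ hm'.ne',
              ENNReal.ofReal_one, one_mul]
    have hsub : {ω | ∃ w ∈ W, σ * (n : ℝ) ^ (-1 / 2 : ℝ) * t * √(N : ℝ) * empNorm (n := n) w
        < |empInner (fun i => e i ω) w|} ⊆ {ω | ENNReal.ofReal (Real.exp (t ^ 2 / 8)) ≤ F ω} := by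
      intro ω hω
      have h1 := hev ω hω
      have h2 : σ ^ 2 * t ^ 2 * m ≤ ∑ j, X j ω ^ 2 :=
        le_trans (by gcongr) h1.le
      have h3 := convexOn_exp.map_sum_le (t := Finset.univ) (w := fun _ : Fin m => (m : ℝ)⁻¹)
        (p := fun j => X j ω ^ 2 / (8 * σ ^ 2)) (fun _ _ => by positivity)
        (by simp [hm'.ne']) (fun _ _ => Set.mem_univ _)
      simp only [smul_eq_mul, ← Finset.mul_sum, ← Finset.sum_div] at h3
      have h4 : t ^ 2 / 8 ≤ (m : ℝ)⁻¹ * ((∑ j, X j ω ^ 2) / (8 * σ ^ 2)) := by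
        rw [inv_mul_eq_div, le_div_iff₀ hm', le_div_iff₀ (by positivity)]
        linarith
      simp only [Set.mem_ofPred_eq, F]
      simp only [← ENNReal.ofReal_mul (inv_nonneg.2 hm'.le)]
      rw [← ENNReal.ofReal_sum_of_nonneg fun j _ => by positivity, ← Finset.mul_sum]
      exact ENNReal.ofReal_le_ofReal ((Real.exp_le_exp.2 h4).trans h3)
    refine (measure_mono hsub).trans ?_
    have hpos' : 0 < Real.exp (t ^ 2 / 8) := Real.exp_pos _
    refine (meas_ge_le_lintegral_div hFm.aemeasurable (ENNReal.ofReal_pos.2 hpos').ne'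
      ENNReal.ofReal_ne_top).trans ?_
    rw [div_eq_mul_inv, ← ENNReal.ofReal_inv_of_pos hpos', ← Real.exp_neg, ← neg_div]
    gcongr

end Noise


/-! ### Chaining over sup-norm nets of the unit ball of `Y`. -/

section Chaining

variable {d : ℕ} {Ω : Set (Space d)} {Y : Type*}
  [NormedAddCommGroup Y] [InnerProductSpace ℝ Y]

theorem CoveringEntropyBound.exists_finset {ι : Y →L[ℝ] (closure Ω →ᵇ ℝ)} {γ C : ℝ}
    (h : CoveringEntropyBound ι γ C) {ε : ℝ} (hε : 0 < ε) :
    ∃ T : Finset (closure Ω →ᵇ ℝ), (T.card : ℝ) ≤ Real.exp (C * ε ^ (-γ)) ∧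
      ∀ u : Y, ‖u‖ ≤ 1 → ∃ f ∈ T, ‖ι u - f‖ ≤ ε := by
  lift ε to ℝ≥0 using hε.le
  set A := ι '' Metric.closedBall (0 : Y) 1
  have h1 := h ε (by exact_mod_cast hε)
  have h2 : ((Metric.coveringNumber ε A : ℕ∞) : ℝ≥0∞) ≤
      ENNReal.ofReal (Real.exp (C * (ε : ℝ) ^ (-γ))) := by
    rw [← ENNReal.log_le_log_iff, ENNReal.log_ofReal_of_pos (Real.exp_pos _), Real.log_exp]
    exact h1
  have h3 : Metric.coveringNumber ε A ≠ ⊤ := fun h => by simp [h] at h2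
  obtain ⟨N, -, hfin, hcov, hcard⟩ := Metric.exists_set_encard_eq_coveringNumber h3
  refine ⟨hfin.toFinset, ?_, fun u hu => ?_⟩
  · rw [← hcard, hfin.encard_eq_coe_toFinset_card, ENat.toENNReal_coe,
      ← ENNReal.ofReal_natCast] at h2
    exact (ENNReal.ofReal_le_ofReal_iff (Real.exp_nonneg _)).1 h2
  · obtain ⟨f, hf, hd⟩ := hcov (Set.mem_image_of_mem ι (mem_closedBall_zero_iff.2 hu))
    refine ⟨f, hfin.mem_toFinset.2 hf, ?_⟩
    have hd' : edist (ι u) f ≤ ε := hd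
    rw [edist_nndist, ENNReal.coe_le_coe, ← NNReal.coe_le_coe, coe_nndist, dist_eq_norm] at hd'
    exact hd'

/-- The values of a bounded continuous function at the observation points. -/
def evalAt {n : ℕ} (x : Fin n → Ω) : (closure Ω →ᵇ ℝ) →ₗ[ℝ] (Fin n → ℝ) where
  toFun f i := f ⟨x i, subset_closure (x i).2⟩
  map_add' _ _ := rfl
  map_smul' _ _ := rfl

theorem sample_eq_evalAt (ι : Y →L[ℝ] (closure Ω →ᵇ ℝ)) {n : ℕ} (x : Fin n → Ω) (u : Y) :
    sample ι x u = evalAt x (ι u) := rfl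

theorem empNorm_evalAt_le {n : ℕ} (x : Fin n → Ω) (f : closure Ω →ᵇ ℝ) :
    empNorm (evalAt x f) ≤ ‖f‖ :=
  empNorm_le_of_forall_abs_le _ (norm_nonneg f) fun i => f.norm_coe_le_norm ⟨x i, _⟩

/-- For `γ ≤ 0` the covering numbers stay below `exp C` as `ε → 0`, whereas a nontrivial segment
needs arbitrarily many small balls. -/
theorem CoveringEntropyBound.eq_zero {ι : Y →L[ℝ] (closure Ω →ᵇ ℝ)} {γ C : ℝ}
    (h : CoveringEntropyBound ι γ C) (hι : Function.Injective ι) (hC : 0 < C) (hγ : γ ≤ 0)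
    (u : Y) : u = 0 := by
  by_contra hu
  obtain ⟨v, hv1⟩ : ∃ v : Y, ‖v‖ = 1 := ⟨‖u‖⁻¹ • u, norm_smul_inv_norm (𝕜 := ℝ) hu⟩
  have hl : 0 < ‖ι v‖ := by
    rw [norm_pos_iff]
    intro h0
    have : v = 0 := hι (by rw [h0, map_zero])
    rw [this, norm_zero] at hv1
    exact zero_ne_one hv1
  set N : ℕ := ⌊Real.exp C⌋₊ + 1 with hN
  have hN0 : (0 : ℝ) < N := by positivity
  -- The `N + 1` points `(i/N) v` are `‖ι v‖/N` apart, more than `2ε`, so no two can share a centre;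
  -- `ε ≤ 1` keeps `ε^{-γ} ≤ 1`.
  set ε : ℝ := min 1 (‖ι v‖ / (3 * N)) with hε
  have hε0 : 0 < ε := lt_min one_pos (by positivity)
  obtain ⟨T, hT, hcov⟩ := h.exists_finset hε0
  have hTN : T.card < (Finset.range (N + 1)).card := by
    rw [Finset.card_range]
    have h1 : (T.card : ℝ) ≤ Real.exp C := hT.trans (Real.exp_le_exp.2 (mul_le_of_le_one_right hC.le
      (Real.rpow_le_one hε0.le (min_le_left _ _) (by linarith))))
    have := Nat.le_floor h1
    omega
  have hpt : ∀ i : ℕ, ∃ f, i ∈ Finset.range (N + 1) → f ∈ T ∧ ‖ι (((i : ℝ) / N) • v) - f‖ ≤ ε := by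
    intro i
    by_cases hi : i ∈ Finset.range (N + 1)
    · have hi' : (i : ℝ) ≤ N := by exact_mod_cast Nat.lt_succ_iff.1 (Finset.mem_range.1 hi)
      obtain ⟨f, hf⟩ := hcov (((i : ℝ) / N) • v) (by
        rw [norm_smul, hv1, mul_one, Real.norm_of_nonneg (by positivity)]
        exact div_le_one_of_le₀ hi' hN0.le)
      exact ⟨f, fun _ => hf⟩
    · exact ⟨0, fun h => absurd h hi⟩
  choose f hf using hpt
  obtain ⟨i, hi, j, hj, hij, hfij⟩ :=
    Finset.exists_ne_map_eq_of_card_lt_of_maps_to hTN (fun i hi => (hf i hi).1)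
  have h1 := (hf i hi).2
  have h2 := (hf j hj).2
  rw [hfij] at h1
  have h3 : ‖ι (((i : ℝ) / N) • v) - ι (((j : ℝ) / N) • v)‖ ≤ ε + ε := by
    refine (norm_sub_le_norm_sub_add_norm_sub _ (f j) _).trans (add_le_add h1 ?_)
    rwa [norm_sub_rev]
  rw [← map_sub, ← sub_smul, map_smul, norm_smul, ← sub_div, norm_div, Real.norm_of_nonneg hN0.le]
    at h3
  have h4 : (1 : ℝ) ≤ ‖(i : ℝ) - j‖ := by
    have : (1 : ℤ) ≤ |(i : ℤ) - j| := Int.one_le_abs (sub_ne_zero.2 (by exact_mod_cast hij))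
    rw [Real.norm_eq_abs]
    exact_mod_cast this
  have h5 : ε ≤ ‖ι v‖ / (3 * N) := min_le_right _ _
  have h6 : 1 / N * ‖ι v‖ ≤ ‖(i : ℝ) - j‖ / N * ‖ι v‖ := by gcongr
  have h7 : ‖ι v‖ / (3 * N) = 1 / N * ‖ι v‖ / 3 := by field_simp
  have h8 : 0 < 1 / N * ‖ι v‖ := by positivity
  linarith

/-- Telescope `u` along its approximants, starting at the level `k` matched to the size of `‖u‖ₙ`
instead of at `0`. The link at level `j` contributes `τ^j 2^{-j}`, so the geometric sum is dominated
by its first term. At `k = 0` no smallness is needed, as `‖u‖ₙ ≤ ‖ι‖` on the unit ball. -/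
theorem abs_empInner_sample_le_of_nets (ι : Y →L[ℝ] (closure Ω →ᵇ ℝ)) {n : ℕ} (x : Fin n → Ω)
    {T : ℕ → Finset (closure Ω →ᵇ ℝ)}
    (hT : ∀ k, ∀ u : Y, ‖u‖ ≤ 1 → ∃ f ∈ T k, ‖ι u - f‖ ≤ (1 / 2 : ℝ) ^ k)
    {y : Fin n → ℝ} {s τ : ℝ} (hs : 0 ≤ s) (hτ : 0 < τ) (hτ2 : τ / 2 < 1)
    (h1 : ∀ k, ∀ f ∈ T k, |empInner y (evalAt x f)| ≤ s * τ ^ k * empNorm (evalAt x f))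
    (h2 : ∀ k, ∀ f ∈ T k, ∀ g ∈ T (k + 1),
      |empInner y (evalAt x (g - f))| ≤ s * τ ^ k * empNorm (evalAt x (g - f)))
    {u : Y} (hu : ‖u‖ ≤ 1) {k : ℕ} (hk : k = 0 ∨ empNorm (sample ι x u) ≤ (1 / 2 : ℝ) ^ k) :
    |empInner y (sample ι x u)| ≤ s * (τ / 2) ^ k * (‖ι‖ + 2 + 2 / (1 - τ / 2)) := by
  choose p hp hpe using fun k => hT k u hu
  set q := τ / 2 with hq
  have hq0 : 0 < q := by positivity
  have hqk : ∀ k, τ ^ k * (1 / 2 : ℝ) ^ k = q ^ k := fun k => by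
    rw [← mul_pow, hq]; congr 1; ring
  have hpk : empNorm (evalAt x (p k)) ≤ (‖ι‖ + 2) * (1 / 2 : ℝ) ^ k := by
    have h3 : empNorm (evalAt x (p k)) ≤ empNorm (sample ι x u) + (1 / 2 : ℝ) ^ k := by
      have : evalAt x (p k) = sample ι x u + evalAt x (p k - ι u) := by
        rw [sample_eq_evalAt, ← map_add]; congr 1; abel
      rw [this]
      refine (empNorm_add_le _ _).trans (add_le_add_right ((empNorm_evalAt_le _ _).trans ?_) _)
      rw [norm_sub_rev]; exact hpe k
    rcases hk with rfl | hk
    · have h4 : empNorm (sample ι x u) ≤ ‖ι‖ :=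
        (empNorm_evalAt_le x (ι u)).trans (ι.unit_le_opNorm u hu)
      simp only [pow_zero] at h3 ⊢
      linarith
    · nlinarith [norm_nonneg ι, pow_pos (one_half_pos (α := ℝ)) k]
  have hstep : ∀ j, |empInner y (evalAt x (p (j + 1) - p j))| ≤ s * q ^ j * 2 := fun j => by
    have h5 : ‖p (j + 1) - p j‖ ≤ 2 * (1 / 2 : ℝ) ^ j := by
      have := norm_sub_le_norm_sub_add_norm_sub (p (j + 1)) (ι u) (p j)
      rw [norm_sub_rev (p (j + 1)) (ι u)] at this
      have h6 := hpe (j + 1)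
      rw [pow_succ] at h6
      have := hpe j
      have := pow_pos (one_half_pos (α := ℝ)) j
      linarith
    calc _ ≤ s * τ ^ j * (2 * (1 / 2 : ℝ) ^ j) := (h2 j _ (hp j) _ (hp (j + 1))).trans
          (mul_le_mul_of_nonneg_left ((empNorm_evalAt_le _ _).trans h5) (by positivity))
      _ = s * q ^ j * 2 := by rw [← hqk]; ring
  have hind : ∀ m, |empInner y (evalAt x (p (k + m)))| ≤
      s * q ^ k * (‖ι‖ + 2 + 2 * ∑ j ∈ Finset.range m, q ^ j) := by
    intro m
    induction m with
    | zero =>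
      calc _ ≤ s * τ ^ k * ((‖ι‖ + 2) * (1 / 2 : ℝ) ^ k) := (h1 k _ (hp k)).trans
            (mul_le_mul_of_nonneg_left hpk (by positivity))
        _ = _ := by rw [← hqk]; simp; ring
    | succ m ih =>
      have h7 : evalAt x (p (k + (m + 1))) =
          evalAt x (p (k + m)) + evalAt x (p (k + m + 1) - p (k + m)) := by
        rw [← map_add]; congr 1; rw [add_assoc]; abel
      rw [h7, empInner_add_right, Finset.sum_range_succ]
      refine (abs_add_le _ _).trans ((add_le_add ih (hstep (k + m))).trans (le_of_eq ?_))
      rw [pow_add]; ring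
  -- The tail of the chain is bounded by Cauchy–Schwarz against the fixed vector `y` and vanishes as
  -- `m → ∞`.
  have hlim : Tendsto (fun m : ℕ => s * q ^ k * (‖ι‖ + 2 + 2 / (1 - q)) +
      empNorm y * (1 / 2 : ℝ) ^ (k + m)) atTop (𝓝 (s * q ^ k * (‖ι‖ + 2 + 2 / (1 - q)))) := by
    have : Tendsto (fun m : ℕ => (1 / 2 : ℝ) ^ (k + m)) atTop (𝓝 0) := by
      simp_rw [pow_add]
      simpa using (tendsto_pow_atTop_nhds_zero_of_lt_one (r := (1 / 2 : ℝ)) (by norm_num)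
        (by norm_num)).const_mul ((1 / 2 : ℝ) ^ k)
    simpa using (this.const_mul (empNorm y)).const_add (s * q ^ k * (‖ι‖ + 2 + 2 / (1 - q)))
  refine ge_of_tendsto' hlim fun m => ?_
  have h8 : sample ι x u = evalAt x (p (k + m)) + evalAt x (ι u - p (k + m)) := by
    rw [sample_eq_evalAt, ← map_add]; congr 1; abel
  rw [h8, empInner_add_right]
  refine (abs_add_le _ _).trans (add_le_add ((hind m).trans ?_) ?_)
  · have : ∑ j ∈ Finset.range m, q ^ j ≤ 1 / (1 - q) := by
      rw [one_div, ← tsum_geometric_of_lt_one hq0.le hτ2]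
      exact (summable_geometric_of_lt_one hq0.le hτ2).sum_le_tsum _ fun _ _ => by positivity
    have h9 : 2 / (1 - q) = 2 * (1 / (1 - q)) := by ring
    rw [h9]
    gcongr
  · exact (abs_empInner_le _ _).trans (mul_le_mul_of_nonneg_left
      ((empNorm_evalAt_le _ _).trans (hpe _)) (empNorm_nonneg _))

/-- At scale `2^{-k}` the entropy is `C θ^k` with `θ = 2^γ`. The threshold `z τ^k` with `τ² = θ`
makes the Gaussian exponent grow at the same rate, so a union bound over net points and links works
for large `z`. The nets live in the sup norm, hence the constants do not see `n` or the points. -/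
theorem exists_maximal_inequality_of_pos (ι : Y →L[ℝ] (closure Ω →ᵇ ℝ)) {γ C : ℝ} (hγ0 : 0 < γ)
    (hγ : γ < 2) (hC : 0 < C) (h : CoveringEntropyBound ι γ C) :
    ∃ K B z₀ : ℝ, 0 < K ∧ 0 < B ∧ 1 ≤ z₀ ∧ ∀ {n : ℕ} (_ : 0 < n) (x : Fin n → Ω)
      {𝔛 : Type*} [MeasurableSpace 𝔛] (P : Measure 𝔛) [IsProbabilityMeasure P]
      (σ : ℝ) (_ : 0 < σ) (e : Fin n → 𝔛 → ℝ) (_ : IsSubGaussianNoise P σ e) (z : ℝ) (_ : z₀ ≤ z),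
      P {ω | ¬ ∀ (u : Y) (r R : ℝ), 0 < r → 0 < R → empNorm (sample ι x u) ≤ r → ‖u‖ ≤ R →
          |empInner (fun i => e i ω) (sample ι x u)|
            ≤ K * (σ * (n : ℝ) ^ (-1 / 2 : ℝ)) * z * (r ^ (1 - γ / 2) * R ^ (γ / 2))}
        ≤ ENNReal.ofReal (B * Real.exp (-z ^ 2 / 4)) := by
  set τ : ℝ := 2 ^ (γ / 2) with hτ
  set θ : ℝ := 2 ^ γ with hθ
  have hτ0 : 0 < τ := by positivity
  have hθτ : τ ^ 2 = θ := by
    rw [hτ, ← Real.rpow_natCast, ← Real.rpow_mul zero_le_two, hθ]; congr 1; push_cast; ring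
  have hθ1 : 1 < θ := Real.one_lt_rpow one_lt_two hγ0
  have hτ2 : τ / 2 < 1 := by
    have : τ < 2 ^ (1 : ℝ) := Real.rpow_lt_rpow_of_exponent_lt one_lt_two (by linarith)
    rw [Real.rpow_one] at this
    linarith
  have hτhalf : τ / 2 = (1 / 2 : ℝ) ^ (1 - γ / 2) := by
    rw [one_div, Real.inv_rpow zero_le_two, ← Real.rpow_neg zero_le_two, neg_sub,
      Real.rpow_sub_one two_ne_zero]
  choose T hTc hT using fun k : ℕ => h.exists_finset (pow_pos (one_half_pos (α := ℝ)) k)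
  have hent : ∀ k : ℕ, ((1 / 2 : ℝ) ^ k) ^ (-γ) = θ ^ k := fun k => by
    rw [← Real.rpow_natCast, ← Real.rpow_mul (by norm_num), one_div, Real.inv_rpow zero_le_two,
      ← Real.rpow_neg zero_le_two, hθ, ← Real.rpow_natCast, ← Real.rpow_mul zero_le_two]
    congr 1; ring
  simp only [hent] at hTc
  -- Ratio of the union bound over `k`: Bernoulli gives `θ^k ≥ 1 + k(θ - 1)`, and `θ > 1` because `γ
  -- > 0`.
  set ρ : ℝ := Real.exp (-((θ - 1) / 4)) with hρ
  have hρ1 : ρ < 1 := by rw [hρ, Real.exp_lt_one_iff]; linarith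
  set M : ℝ := ‖ι‖ + 2 + 2 / (1 - τ / 2) with hM
  have hM0 : 0 < M := by
    have : 0 < 1 - τ / 2 := by linarith
    positivity
  refine ⟨2 ^ (1 - γ / 2) * M, 4 * (1 - ρ)⁻¹, 1 + 4 * C * (1 + θ), by positivity,
    mul_pos four_pos (inv_pos.2 (by linarith)), by nlinarith [mul_pos hC (zero_lt_one.trans hθ1)],
    ?_⟩
  intro n hn x 𝔛 _ P _ σ hσ e he z hz
  have hn' : (0 : ℝ) < n := Nat.cast_pos.2 hn
  have hz1 : 1 ≤ z := le_trans (by nlinarith [mul_pos hC (zero_lt_one.trans hθ1)]) hz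
  -- The entropy `C(1 + θ)θ^k` of pairs from consecutive nets then uses at most half of the exponent
  -- `z² θ^k / 2`.
  have hz2 : 4 * C * (1 + θ) ≤ z ^ 2 := by nlinarith
  set s : ℝ := σ * (n : ℝ) ^ (-1 / 2 : ℝ) with hs
  have hs0 : 0 < s := by positivity
  let Bad : ℕ → (Fin n → ℝ) → Set 𝔛 := fun k a =>
    {ω | s * (z * τ ^ k) * empNorm a < |empInner (fun i => e i ω) a|}
  have hBad : ∀ k a, P (Bad k a) ≤ ENNReal.ofReal (2 * Real.exp (-(z ^ 2 * θ ^ k) / 2)) := by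
    intro k a
    have := he.measure_lt_abs_empInner_le hn hσ a (t := z * τ ^ k) (by positivity)
    rwa [mul_pow, ← pow_mul, mul_comm k 2, pow_mul, hθτ] at this
  let A : Set 𝔛 := ⋃ k, ⋃ f ∈ T k, ⋃ g ∈ T (k + 1),
    (Bad k (evalAt x f) ∪ Bad k (evalAt x (g - f)))
  have hA : P A ≤ ENNReal.ofReal (4 * (1 - ρ)⁻¹ * Real.exp (-z ^ 2 / 4)) := by
    have hk : ∀ k, P (⋃ f ∈ T k, ⋃ g ∈ T (k + 1),
        (Bad k (evalAt x f) ∪ Bad k (evalAt x (g - f)))) ≤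
        ENNReal.ofReal (4 * Real.exp (-z ^ 2 / 4) * ρ ^ k) := by
      intro k
      set c : ℝ := 4 * Real.exp (-(z ^ 2 * θ ^ k) / 2) with hc
      have h2 : ∀ f g, P (Bad k (evalAt x f) ∪ Bad k (evalAt x (g - f))) ≤ ENNReal.ofReal c :=
        fun f g => by
          refine (measure_union_le _ _).trans ((add_le_add (hBad _ _) (hBad _ _)).trans ?_)
          rw [← ENNReal.ofReal_add (by positivity) (by positivity)]
          exact ENNReal.ofReal_le_ofReal (by rw [hc]; linarith)
      have h3 : P (⋃ f ∈ T k, ⋃ g ∈ T (k + 1),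
          (Bad k (evalAt x f) ∪ Bad k (evalAt x (g - f)))) ≤
          ∑ _f ∈ T k, ∑ _g ∈ T (k + 1), ENNReal.ofReal c :=
        (measure_biUnion_finset_le _ _).trans (Finset.sum_le_sum fun f _ =>
          (measure_biUnion_finset_le _ _).trans (Finset.sum_le_sum fun g _ => h2 f g))
      refine h3.trans ?_
      rw [Finset.sum_const, Finset.sum_const, nsmul_eq_mul, nsmul_eq_mul, ← ENNReal.ofReal_natCast,
        ← ENNReal.ofReal_natCast, ← ENNReal.ofReal_mul (by positivity),
        ← ENNReal.ofReal_mul (by positivity)]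
      refine ENNReal.ofReal_le_ofReal ?_
      have hbern : 1 + (k : ℝ) * (θ - 1) ≤ θ ^ k := by
        have := one_add_mul_le_pow (a := θ - 1) (by linarith) k
        rwa [add_sub_cancel] at this
      calc ((T k).card : ℝ) * ((T (k + 1)).card * c)
          ≤ Real.exp (C * θ ^ k) * (Real.exp (C * θ ^ (k + 1)) * c) := by
            gcongr
            · exact hTc k
            · exact hTc (k + 1)
        _ = 4 * Real.exp (C * θ ^ k + C * θ ^ (k + 1) + -(z ^ 2 * θ ^ k) / 2) := by
            rw [Real.exp_add, Real.exp_add, hc]; ring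
        _ ≤ 4 * Real.exp (-z ^ 2 / 4 + k * -((θ - 1) / 4)) := by
            refine mul_le_mul_of_nonneg_left (Real.exp_le_exp.2 ?_) zero_le_four
            have h5 : 4 * C * (1 + θ) * θ ^ k ≤ z ^ 2 * θ ^ k := by gcongr
            have h6 : z ^ 2 * (1 + k * (θ - 1)) ≤ z ^ 2 * θ ^ k := by gcongr
            have h7 : 1 * (k * (θ - 1)) ≤ z ^ 2 * (k * (θ - 1)) :=
              mul_le_mul_of_nonneg_right (one_le_pow₀ hz1)
                (mul_nonneg (Nat.cast_nonneg k) (by linarith))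
            rw [pow_succ]
            linarith
        _ = 4 * Real.exp (-z ^ 2 / 4) * ρ ^ k := by
            rw [Real.exp_add, Real.exp_nat_mul]; ring
    have hρ0 : 0 ≤ ρ := Real.exp_nonneg _
    calc P A ≤ ∑' k : ℕ, ENNReal.ofReal (4 * Real.exp (-z ^ 2 / 4) * ρ ^ k) :=
          (measure_iUnion_le _).trans (ENNReal.tsum_le_tsum hk)
      _ = _ := by
          rw [← ENNReal.ofReal_tsum_of_nonneg (fun k => by positivity)
            ((summable_geometric_of_lt_one hρ0 hρ1).mul_left _), tsum_mul_left,
            tsum_geometric_of_lt_one hρ0 hρ1]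
          congr 1; ring
  refine (measure_mono fun ω hω => ?_).trans hA
  by_contra hωA
  refine hω fun u r R hr hR hur huR => ?_
  have hgood : ∀ k, ∀ f ∈ T k, ∀ g ∈ T (k + 1),
      |empInner (fun i => e i ω) (evalAt x f)| ≤ s * (z * τ ^ k) * empNorm (evalAt x f) ∧
      |empInner (fun i => e i ω) (evalAt x (g - f))|
        ≤ s * (z * τ ^ k) * empNorm (evalAt x (g - f)) := by
    intro k f hf g hg
    have h1 : ω ∉ Bad k (evalAt x f) ∪ Bad k (evalAt x (g - f)) := fun h1 =>
      hωA (Set.mem_iUnion.2 ⟨k, Set.mem_iUnion₂.2 ⟨f, hf, Set.mem_iUnion₂.2 ⟨g, hg, h1⟩⟩⟩)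
    exact ⟨not_lt.1 fun h2 => h1 (Or.inl h2), not_lt.1 fun h2 => h1 (Or.inr h2)⟩
  simp only [← mul_assoc] at hgood
  have hchain := fun (v : Y) (hv : ‖v‖ ≤ 1) (k : ℕ) hk =>
    abs_empInner_sample_le_of_nets ι x hT (y := fun i => e i ω) (s := s * z) (τ := τ)
    (by positivity) hτ0 hτ2
    (fun k f hf => by
      -- Any point of the next net will do: the good event is stated for pairs.
      obtain ⟨g, hg, -⟩ := hT (k + 1) 0 (by simp)
      exact (hgood k f hf g hg).1)
    (fun k f hf g hg => (hgood k f hf g hg).2) (u := v) hv (k := k) hk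
  have hsc : sample ι x (R⁻¹ • u) = R⁻¹ • sample ι x u := by
    rw [sample_eq_evalAt, sample_eq_evalAt, map_smul, map_smul]
  -- Starting level: round `r/R` up to a power of `1/2`, which loses a factor at most `2`; take
  -- level `0` if `r/R ≥ 1`.
  have hq : ∃ k : ℕ, (k = 0 ∨ empNorm (sample ι x (R⁻¹ • u)) ≤ (1 / 2 : ℝ) ^ k) ∧
      (1 / 2 : ℝ) ^ k ≤ 2 * (r / R) := by
    have hrR : 0 < r / R := by positivity
    rcases le_total 1 (r / R) with h1 | h1
    · exact ⟨0, Or.inl rfl, by rw [pow_zero]; linarith⟩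
    · obtain ⟨k, hk1, hk2⟩ := exists_nat_pow_near_of_lt_one hrR h1 (one_half_pos (α := ℝ))
        one_half_lt_one
      refine ⟨k, Or.inr ?_, ?_⟩
      · rw [hsc, empNorm_smul, abs_of_pos (inv_pos.2 hR), inv_mul_eq_div]
        exact (div_le_div_of_nonneg_right hur hR.le).trans hk2
      · rw [pow_succ] at hk1; linarith
  obtain ⟨k, hk, hkr⟩ := hq
  have hnv : ‖R⁻¹ • u‖ ≤ 1 := by
    rw [norm_smul, norm_inv, Real.norm_of_nonneg hR.le, inv_mul_le_iff₀ hR, mul_one]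
    exact huR
  have h9 := hchain _ hnv k hk
  rw [hsc, empInner_smul_right, abs_mul, abs_of_pos (inv_pos.2 hR), inv_mul_le_iff₀ hR] at h9
  refine h9.trans ?_
  have h10 : (τ / 2) ^ k ≤ 2 ^ (1 - γ / 2) * (r ^ (1 - γ / 2) / R ^ (1 - γ / 2)) := by
    rw [hτhalf, ← Real.rpow_natCast, ← Real.rpow_mul (by norm_num), mul_comm,
      Real.rpow_mul (by norm_num), Real.rpow_natCast, ← Real.div_rpow hr.le hR.le,
      ← Real.mul_rpow zero_le_two (by positivity)]
    exact Real.rpow_le_rpow (by positivity) hkr (by linarith)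
  have h11 : R ^ (γ / 2) = R / R ^ (1 - γ / 2) := by
    rw [eq_div_iff (by positivity), ← Real.rpow_add hR]
    norm_num
  calc R * (s * z * (τ / 2) ^ k * M)
      ≤ R * (s * z * (2 ^ (1 - γ / 2) * (r ^ (1 - γ / 2) / R ^ (1 - γ / 2))) * M) := by gcongr
    _ = _ := by rw [h11]; ring

theorem exists_maximal_inequality (ι : Y →L[ℝ] (closure Ω →ᵇ ℝ)) (hι : Function.Injective ι)
    {γ C : ℝ} (hγ : γ < 2) (hC : 0 < C) (h : CoveringEntropyBound ι γ C) :
    ∃ K B z₀ : ℝ, 0 < K ∧ 0 < B ∧ 1 ≤ z₀ ∧ ∀ {n : ℕ} (_ : 0 < n) (x : Fin n → Ω)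
      {𝔛 : Type*} [MeasurableSpace 𝔛] (P : Measure 𝔛) [IsProbabilityMeasure P]
      (σ : ℝ) (_ : 0 < σ) (e : Fin n → 𝔛 → ℝ) (_ : IsSubGaussianNoise P σ e) (z : ℝ) (_ : z₀ ≤ z),
      P {ω | ¬ ∀ (u : Y) (r R : ℝ), 0 < r → 0 < R → empNorm (sample ι x u) ≤ r → ‖u‖ ≤ R →
          |empInner (fun i => e i ω) (sample ι x u)|
            ≤ K * (σ * (n : ℝ) ^ (-1 / 2 : ℝ)) * z * (r ^ (1 - γ / 2) * R ^ (γ / 2))}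
        ≤ ENNReal.ofReal (B * Real.exp (-z ^ 2 / 4)) := by
  rcases lt_or_ge 0 γ with hγ0 | hγ0
  · exact exists_maximal_inequality_of_pos ι hγ0 hγ hC h
  · refine ⟨1, 1, 1, one_pos, one_pos, le_rfl, ?_⟩
    intro n hn x 𝔛 _ P _ σ hσ e he z hz
    refine le_of_eq_of_le (measure_mono_null (t := ∅) (fun ω hω => ?_) measure_empty) zero_le
    rw [Set.mem_ofPred_eq] at hω
    refine absurd ?_ hω
    intro u r R hr hR _ _
    have hs : sample ι x (0 : Y) = 0 := by rw [sample_eq_evalAt, map_zero, map_zero]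
    rw [h.eq_zero hι hC hγ0 u, hs]
    simp only [empInner, Pi.zero_apply, mul_zero, Finset.sum_const_zero, abs_zero]
    have : 0 ≤ z := zero_le_one.trans hz
    positivity

end Chaining


/-! ### The deterministic energy estimate. -/

section ErrorEstimate

variable {d : ℕ} {Ω : Set (Space d)} {X Y : Type*}
  [NormedAddCommGroup X] [InnerProductSpace ℝ X]
  [NormedAddCommGroup Y] [InnerProductSpace ℝ Y]

theorem sample_add (ι : Y →L[ℝ] (closure Ω →ᵇ ℝ)) {n : ℕ} (x : Fin n → Ω) (u v : Y) :
    sample ι x (u + v) = sample ι x u + sample ι x v := by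
  simp only [sample_eq_evalAt, map_add]

theorem sample_sub (ι : Y →L[ℝ] (closure Ω →ᵇ ℝ)) {n : ℕ} (x : Fin n → Ω) (u v : Y) :
    sample ι x (u - v) = sample ι x u - sample ι x v := by
  simp only [sample_eq_evalAt, map_sub]

theorem empNorm_sample_add_le (ι : Y →L[ℝ] (closure Ω →ᵇ ℝ)) {n : ℕ} (x : Fin n → Ω) (u v : Y) :
    empNorm (sample ι x (u + v)) ≤ empNorm (sample ι x u) + empNorm (sample ι x v) := by
  rw [sample_add]; exact empNorm_add_le _ _

theorem empNorm_sample_sub_comm (ι : Y →L[ℝ] (closure Ω →ᵇ ℝ)) {n : ℕ} (x : Fin n → Ω)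
    (u v : Y) : empNorm (sample ι x (u - v)) = empNorm (sample ι x (v - u)) := by
  rw [sample_sub, sample_sub, ← neg_sub, empNorm_neg]

set_option maxHeartbeats 600000 in
/-- The deterministic part of the error analysis: on the event where the noise satisfies the
bounds `hY` and `hV`, the error is controlled by `z`. -/
theorem exists_error_bound (S : X →L[ℝ] Y) (γ C₃ C₄ C₅ K : ℝ) (hC₃ : 0 < C₃)
    (hC₄ : 0 < C₄) (hC₅ : 0 < C₅) (hK : 0 < K) :
    ∃ M : ℝ, 0 < M ∧ ∀ (ι : Y →L[ℝ] (closure Ω →ᵇ ℝ)) {n : ℕ} (x : Fin n → Ω)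
      (D : Discretization X Y) (μ eh s ρ₀ z : ℝ) (fstar f : X) (y : Fin n → ℝ),
      0 < μ → 0 ≤ eh → 0 ≤ s → 0 < ρ₀ → 1 ≤ z → ‖fstar‖ ≤ ρ₀ →
      D.Approximates ι S x (μ ^ 2) eh C₃ → eh ≤ C₄ * μ ^ 2 →
      (D.dimVh : ℝ) * eh ≤ C₄ * μ ^ (2 - γ) → s ≤ C₅ * μ ^ (1 + γ / 2) * ρ₀ →
      (∀ (u : Y) (r R : ℝ), 0 < r → 0 < R → empNorm (sample ι x u) ≤ r → ‖u‖ ≤ R →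
        |empInner y (sample ι x u)| ≤ K * s * z * (r ^ (1 - γ / 2) * R ^ (γ / 2))) →
      (∀ g ∈ D.Vh, |empInner y (sample ι x (S g - D.Sh g))| ≤
        s * z * √(D.dimVh : ℝ) * empNorm (sample ι x (S g - D.Sh g))) →
      D.IsSolution ι x (μ ^ 2) (fun i => sample ι x (S fstar) i + y i) f →
      empNorm (sample ι x (D.Sh f - S fstar)) ≤ M * (μ * ρ₀ * z) ∧ ‖f‖ ≤ M * (ρ₀ * z) ∧
      ‖f - fstar‖ ≤ M * (ρ₀ * z) ∧ empNorm (sample ι x (S (f - fstar))) ≤ M * (μ * ρ₀ * z) := by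
  set c₃ : ℝ := √(C₃ * (1 + C₄)) with hc₃
  set c₄ : ℝ := √(C₃ * C₄) with hc₄
  -- `‖S‖ + 1` instead of `‖S‖` keeps the radius `R` positive even if `S = 0`.
  set L : ℝ := (1 + c₄) ^ (1 - γ / 2) * (‖S‖ + 1) ^ (γ / 2) with hL
  set M₀ : ℝ := (c₃ + c₄) + K * L * C₅ + c₄ * C₅ + (1 + c₃) with hM₀
  have hc₃0 : 0 ≤ c₃ := Real.sqrt_nonneg _
  have hc₄0 : 0 ≤ c₄ := Real.sqrt_nonneg _
  have hL0 : 0 < L := by positivity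
  have hM₀0 : 0 ≤ M₀ := by positivity
  refine ⟨(1 + c₄) * (M₀ + c₃ + c₄ + 1), by positivity, ?_⟩
  intro ι n x D μ eh s ρ₀ z fstar f y hμ heh hs hρ hz hf happ heh1 heh2 hs1 hY hV hsol
  have hz0 : 0 ≤ z := by linarith
  have hSn : ∀ g : X, empNorm (sample ι x (S g - D.Sh g)) ≤ √(C₃ * eh) * ‖g‖ := fun g => by
    refine abs_le_of_sq_le_sq' ?_ (by positivity) |>.2
    rw [mul_pow, Real.sq_sqrt (by positivity)]
    exact happ.operator_error g
  have hce : √(C₃ * eh) ≤ c₄ * μ := by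
    rw [hc₄, ← Real.sqrt_sq hμ.le, ← Real.sqrt_mul (by positivity), mul_assoc]
    exact Real.sqrt_le_sqrt (by gcongr)
  have hSn' : ∀ g : X, empNorm (sample ι x (S g - D.Sh g)) ≤ c₄ * μ * ‖g‖ := fun g =>
    (hSn g).trans (by gcongr)
  obtain ⟨v, hv, hva⟩ := happ.space_error fstar
  have hva' : μ ^ 2 * ‖fstar - v‖ ^ 2 + empNorm (sample ι x (D.Sh fstar - D.Sh v)) ^ 2
      ≤ (c₃ * μ * ρ₀) ^ 2 := by
    refine hva.trans ?_
    rw [mul_pow, mul_pow, hc₃, Real.sq_sqrt (by positivity)]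
    have : C₃ * (μ ^ 2 + eh) ≤ C₃ * (1 + C₄) * μ ^ 2 := by
      linarith [mul_le_mul_of_nonneg_left heh1 hC₃.le]
    gcongr
  have hv1 : ‖fstar - v‖ ≤ c₃ * ρ₀ := by
    have h1 : (μ * ‖fstar - v‖) ^ 2 ≤ (c₃ * μ * ρ₀) ^ 2 := by
      rw [mul_pow]; exact (le_add_of_nonneg_right (sq_nonneg _)).trans hva'
    have h2 := (abs_le_of_sq_le_sq' h1 (by positivity)).2
    refine le_of_mul_le_mul_left (h2.trans (le_of_eq ?_)) hμ
    ring
  have hv2 : empNorm (sample ι x (D.Sh fstar - D.Sh v)) ≤ c₃ * μ * ρ₀ :=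
    (abs_le_of_sq_le_sq' ((le_add_of_nonneg_left (by positivity)).trans hva') (by positivity)).2
  have hSf : empNorm (sample ι x (S fstar - D.Sh fstar)) ≤ c₄ * μ * ρ₀ :=
    (hSn' fstar).trans (by gcongr)
  set g : X := f - v with hg
  have hgV : g ∈ D.Vh := D.Vh.sub_mem hsol.1 hv
  have hfg : f = g + v := by rw [hg]; abel
  set a : ℝ := ‖g‖ with ha
  set b : ℝ := empNorm (sample ι x (D.Sh g)) with hb
  have ha0 : 0 ≤ a := norm_nonneg g
  have hb0 : 0 ≤ b := empNorm_nonneg _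
  set E : ℝ := √(μ ^ 2 * a ^ 2 + b ^ 2) with hE
  have hE0 : 0 ≤ E := Real.sqrt_nonneg _
  have hE2 : E ^ 2 = μ ^ 2 * a ^ 2 + b ^ 2 := Real.sq_sqrt (by positivity)
  have haE : μ * a ≤ E := Real.le_sqrt_of_sq_le (by
    rw [mul_pow]; exact le_add_of_nonneg_right (sq_nonneg b))
  have hbE : b ≤ E := Real.le_sqrt_of_sq_le (le_add_of_nonneg_left (by positivity))
  have henergy : E ^ 2 = empInner (sample ι x (S fstar - D.Sh v)) (sample ι x (D.Sh g)) +
      empInner y (sample ι x (D.Sh g)) - μ ^ 2 * inner ℝ v g := by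
    have h1 := hsol.2 g hgV
    have h2 : (fun i => sample ι x (S fstar) i + y i) = sample ι x (S fstar) + y := rfl
    rw [h2, empInner_add_left, hfg, map_add, sample_add, empInner_add_left, empInner_self,
      inner_add_left, real_inner_self_eq_norm_sq] at h1
    rw [sample_sub, empInner_sub_left, hE2]
    linarith
  have hμγ : μ ^ (1 + γ / 2) = μ * μ ^ (γ / 2) := by rw [Real.rpow_add hμ, Real.rpow_one]
  have hρz : ρ₀ ≤ ρ₀ * z := le_mul_of_one_le_right hρ.le hz
  have hμρz : μ * ρ₀ ≤ μ * ρ₀ * z := le_mul_of_one_le_right (by positivity) hz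
  have hEbound : E ≤ M₀ * (μ * ρ₀ * z) := by
    rcases hE0.eq_or_lt with h0 | hEpos
    · rw [← h0]; positivity
    have hn1 : |empInner y (sample ι x (S g))| ≤ K * L * C₅ * (μ * ρ₀ * z) * E := by
      have h1 : empNorm (sample ι x (S g)) ≤ (1 + c₄) * E := by
        have h2 : S g = (S g - D.Sh g) + D.Sh g := by abel
        rw [h2]
        refine (empNorm_sample_add_le ι x _ _).trans ((add_le_add (hSn' g) hbE).trans ?_)
        linarith [mul_le_mul_of_nonneg_left haE hc₄0]
      have h3 : ‖S g‖ ≤ (‖S‖ + 1) * (E / μ) := by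
        refine (S.le_opNorm g).trans (mul_le_mul (by linarith) ?_ ha0 (by positivity))
        rw [le_div_iff₀ hμ, mul_comm]; exact haE
      refine (hY (S g) _ _ (by positivity) (by positivity) h1 h3).trans ?_
      -- The powers of `E` add up to one; the loss `μ^{-γ/2}` is what the bound on the noise level
      -- `s` compensates.
      have h4 : ((1 + c₄) * E) ^ (1 - γ / 2) * ((‖S‖ + 1) * (E / μ)) ^ (γ / 2) =
          L * E / μ ^ (γ / 2) := by
        rw [Real.mul_rpow (by positivity) hE0, Real.mul_rpow (by positivity) (by positivity),
          Real.div_rpow hE0 hμ.le, hL]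
        have h5 : E = E ^ (1 - γ / 2) * E ^ (γ / 2) := by
          rw [← Real.rpow_add hEpos, sub_add_cancel, Real.rpow_one]
        nth_rw 3 [h5]
        ring
      rw [h4]
      have hμg : 0 < μ ^ (γ / 2) := by positivity
      calc K * s * z * (L * E / μ ^ (γ / 2))
          ≤ K * (C₅ * (μ * μ ^ (γ / 2)) * ρ₀) * z * (L * E / μ ^ (γ / 2)) := by
            rw [← hμγ]; gcongr
        _ = _ := by field_simp
    have hn2 : |empInner y (sample ι x (S g - D.Sh g))| ≤ c₄ * C₅ * (μ * ρ₀ * z) * E := by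
      -- The consistency error pays for the factor `√N_h`; this is where the bound on `N_h e(h)`
      -- enters.
      have h1 : √(D.dimVh : ℝ) * √(C₃ * eh) ≤ c₄ * μ ^ (1 - γ / 2) := by
        have h2 : μ ^ (1 - γ / 2) = √(μ ^ (2 - γ)) := by
          rw [Real.sqrt_eq_rpow, ← Real.rpow_mul hμ.le]; congr 1; ring
        rw [h2, hc₄, ← Real.sqrt_mul (by positivity), ← Real.sqrt_mul (by positivity)]
        refine Real.sqrt_le_sqrt ?_
        calc (D.dimVh : ℝ) * (C₃ * eh) = C₃ * (D.dimVh * eh) := by ring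
          _ ≤ C₃ * (C₄ * μ ^ (2 - γ)) := by gcongr
          _ = _ := by ring
      have h3 : μ ^ (1 + γ / 2) * μ ^ (1 - γ / 2) = μ * μ := by
        rw [← Real.rpow_add hμ, ← sq, ← Real.rpow_natCast]; congr 1; push_cast; ring
      calc _ ≤ s * z * √(D.dimVh : ℝ) * (√(C₃ * eh) * a) :=
            (hV g hgV).trans (mul_le_mul_of_nonneg_left (hSn g) (by positivity))
        _ = s * z * (√(D.dimVh : ℝ) * √(C₃ * eh)) * a := by ring
        _ ≤ (C₅ * μ ^ (1 + γ / 2) * ρ₀) * z * (c₄ * μ ^ (1 - γ / 2)) * a := by gcongr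
        _ = C₅ * c₄ * ρ₀ * z * (μ ^ (1 + γ / 2) * μ ^ (1 - γ / 2)) * a := by ring
        _ = c₄ * C₅ * (μ * ρ₀ * z) * (μ * a) := by rw [h3]; ring
        _ ≤ _ := by gcongr
    have ht1 : empInner (sample ι x (S fstar - D.Sh v)) (sample ι x (D.Sh g)) ≤
        (c₃ + c₄) * (μ * ρ₀ * z) * E := by
      have h1 : empNorm (sample ι x (S fstar - D.Sh v)) ≤ (c₃ + c₄) * (μ * ρ₀) := by
        have h2 : S fstar - D.Sh v = (S fstar - D.Sh fstar) + (D.Sh fstar - D.Sh v) := by abel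
        rw [h2]
        refine (empNorm_sample_add_le ι x _ _).trans ((add_le_add hSf hv2).trans (le_of_eq ?_))
        ring
      refine (le_abs_self _).trans ((abs_empInner_le _ _).trans ?_)
      exact mul_le_mul (h1.trans (mul_le_mul_of_nonneg_left hμρz (by positivity))) hbE hb0
        (by positivity)
    have ht3 : -(μ ^ 2 * inner ℝ v g) ≤ (1 + c₃) * (μ * ρ₀ * z) * E := by
      have h1 : ‖v‖ ≤ (1 + c₃) * ρ₀ := by
        have h2 : v = fstar - (fstar - v) := by abel
        rw [h2]
        refine (norm_sub_le _ _).trans ((add_le_add hf hv1).trans (le_of_eq ?_))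
        ring
      have h3 : -inner ℝ v g ≤ ‖v‖ * a := (neg_le_abs _).trans (abs_real_inner_le_norm v g)
      calc -(μ ^ 2 * inner ℝ v g) = μ ^ 2 * -inner ℝ v g := by ring
        _ ≤ μ ^ 2 * ((1 + c₃) * ρ₀ * a) := by
            gcongr
            exact h3.trans (by gcongr)
        _ = (1 + c₃) * (μ * ρ₀) * (μ * a) := by ring
        _ ≤ (1 + c₃) * (μ * ρ₀ * z) * E :=
            mul_le_mul (mul_le_mul_of_nonneg_left hμρz (by positivity)) haE (by positivity)
              (by positivity)
    have hnoise : empInner y (sample ι x (D.Sh g)) ≤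
        K * L * C₅ * (μ * ρ₀ * z) * E + c₄ * C₅ * (μ * ρ₀ * z) * E := by
      have h1 : D.Sh g = S g - (S g - D.Sh g) := by abel
      rw [h1, sample_sub, empInner_sub_right]
      linarith [(abs_le.1 hn1).2, (abs_le.1 hn2).1]
    refine le_of_mul_le_mul_right (a := E) ?_ hEpos
    rw [← sq, henergy, hM₀]
    linarith
  have hgz : a ≤ M₀ * (ρ₀ * z) := by
    refine le_of_mul_le_mul_left (haE.trans (hEbound.trans (le_of_eq ?_))) hμ
    ring
  have hff : ‖f - fstar‖ ≤ (M₀ + c₃) * (ρ₀ * z) := by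
    have h1 : f - fstar = g - (fstar - v) := by rw [hg]; abel
    rw [h1]
    refine (norm_sub_le _ _).trans ((add_le_add hgz hv1).trans ?_)
    linarith [mul_le_mul_of_nonneg_left hρz hc₃0]
  have hfn : ‖f‖ ≤ (M₀ + c₃ + 1) * (ρ₀ * z) := by
    have h1 : f = (f - fstar) + fstar := by abel
    rw [h1]
    refine (norm_add_le _ _).trans ((add_le_add hff hf).trans ?_)
    linarith
  have hSh : empNorm (sample ι x (D.Sh f - S fstar)) ≤ (M₀ + c₃ + c₄) * (μ * ρ₀ * z) := by
    have h1 : D.Sh f - S fstar = (D.Sh g + (D.Sh v - D.Sh fstar)) + (D.Sh fstar - S fstar) := by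
      rw [hg, map_sub]; abel
    rw [h1]
    refine (empNorm_sample_add_le ι x _ _).trans
      ((add_le_add (empNorm_sample_add_le ι x _ _) le_rfl).trans ?_)
    rw [empNorm_sample_sub_comm ι x (D.Sh v), empNorm_sample_sub_comm ι x _ (S fstar)]
    have := mul_le_mul_of_nonneg_left hμρz hc₃0
    have := mul_le_mul_of_nonneg_left hμρz hc₄0
    linarith
  have hSS : empNorm (sample ι x (S (f - fstar))) ≤
      c₄ * ((M₀ + c₃ + 1) * (μ * ρ₀ * z)) + (M₀ + c₃ + c₄) * (μ * ρ₀ * z) := by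
    have h1 : S (f - fstar) = (S f - D.Sh f) + (D.Sh f - S fstar) := by rw [map_sub]; abel
    rw [h1]
    refine (empNorm_sample_add_le ι x _ _).trans (add_le_add ((hSn' f).trans ?_) hSh)
    calc c₄ * μ * ‖f‖ ≤ c₄ * μ * ((M₀ + c₃ + 1) * (ρ₀ * z)) := by gcongr
      _ = _ := by ring
  have hT : ∀ t : ℝ, 0 ≤ t → (M₀ + c₃ + c₄ + 1) * t ≤
      (1 + c₄) * (M₀ + c₃ + c₄ + 1) * t := fun t ht => by
    have : 0 ≤ c₄ * ((M₀ + c₃ + c₄ + 1) * t) := by positivity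
    linarith
  have hp : 0 ≤ ρ₀ * z := by positivity
  have hq : 0 ≤ μ * ρ₀ * z := by positivity
  refine ⟨hSh.trans (le_trans ?_ (hT _ hq)), hfn.trans (le_trans ?_ (hT _ hp)),
    hff.trans (le_trans ?_ (hT _ hp)), hSS.trans ?_⟩
  · exact mul_le_mul_of_nonneg_right (by linarith) hq
  · exact mul_le_mul_of_nonneg_right (by linarith) hp
  · exact mul_le_mul_of_nonneg_right (by linarith) hp
  · have := mul_nonneg (mul_nonneg hc₄0 hc₄0) hq
    linarith

end ErrorEstimate


/-! ### The `Z'` norm by interpolation between `X` and `L²(Ω)`. -/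

section DualNorm

variable {d : ℕ} {Ω : Set (Space d)} {X Y : Type*}
  [NormedAddCommGroup X] [InnerProductSpace ℝ X]
  [NormedAddCommGroup Y] [InnerProductSpace ℝ Y]

theorem isFiniteMeasure_volOn (hΩo : IsOpen Ω) (hΩb : Bornology.IsBounded Ω) :
    IsFiniteMeasure (volOn Ω) := by
  refine ⟨?_⟩
  rw [volOn, (MeasurableEmbedding.subtype_coe hΩo.measurableSet).comap_apply]
  exact (measure_mono (by simp)).trans_lt hΩb.measure_lt_top

theorem integrable_value_mul (hΩo : IsOpen Ω) (hΩb : Bornology.IsBounded Ω)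
    (ι : Y →L[ℝ] (closure Ω →ᵇ ℝ)) (u v : Y) :
    Integrable (fun p => value ι u p * value ι v p) (volOn Ω) := by
  have := isFiniteMeasure_volOn hΩo hΩb
  have hc : ∀ w : Y, Continuous (value ι w) := fun w =>
    (ι w).continuous.comp (continuous_subtype_val.subtype_mk fun p => subset_closure p.2)
  refine Integrable.of_bound ((hc u).mul (hc v)).aestronglyMeasurable (‖ι u‖ * ‖ι v‖)
    (ae_of_all _ fun p => ?_)
  rw [norm_mul]
  exact mul_le_mul ((ι u).norm_coe_le_norm _) ((ι v).norm_coe_le_norm _) (norm_nonneg _)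
    (norm_nonneg _)

theorem l2Inner_comm (ι : Y →L[ℝ] (closure Ω →ᵇ ℝ)) (u v : Y) :
    l2Inner ι u v = l2Inner ι v u := by
  simp only [l2Inner, mul_comm]

theorem l2Inner_self_nonneg (ι : Y →L[ℝ] (closure Ω →ᵇ ℝ)) (u : Y) : 0 ≤ l2Inner ι u u :=
  integral_nonneg fun p => mul_self_nonneg (value ι u p)

/-- The inner product of `L²(Ω)` as a linear function of its first argument. -/
noncomputable def l2InnerLeft (hΩo : IsOpen Ω) (hΩb : Bornology.IsBounded Ω)
    (ι : Y →L[ℝ] (closure Ω →ᵇ ℝ)) (w : Y) : Y →ₗ[ℝ] ℝ where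
  toFun u := l2Inner ι u w
  map_add' u v := by
    simp only [l2Inner]
    rw [← integral_add (integrable_value_mul hΩo hΩb ι u w) (integrable_value_mul hΩo hΩb ι v w)]
    refine integral_congr_ae (ae_of_all _ fun p => ?_)
    simp [value, add_mul]
  map_smul' c u := by
    simp only [l2Inner, RingHom.id_apply, smul_eq_mul]
    rw [← integral_const_mul]
    refine integral_congr_ae (ae_of_all _ fun p => ?_)
    simp [value, mul_assoc]

/-- Bessel's inequality for the images of the eigenfunctions in `L²(Ω)`. -/
theorem IsEigenBasis.sum_inv_mul_inner_sq_le (hΩo : IsOpen Ω) (hΩb : Bornology.IsBounded Ω)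
    {ι : Y →L[ℝ] (closure Ω →ᵇ ℝ)} {S : X →L[ℝ] Y} {η : ℕ → ℝ} {φ : HilbertBasis ℕ ℝ X}
    (h : IsEigenBasis ι S η φ) (v : X) (F : Finset ℕ) :
    ∑ k ∈ F, (η k)⁻¹ * inner ℝ (φ k) v ^ 2 ≤ l2Inner ι (S v) (S v) := by
  set a : X := ∑ k ∈ F, inner ℝ (φ k) v • φ k with ha
  have hE : ∀ k u, l2Inner ι (S (φ k)) (S u) = (η k)⁻¹ * inner ℝ (φ k) u := fun k u => by
    rw [h.eigen k u, inv_mul_cancel_left₀ (h.pos k).ne']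
  have hl : ∀ u, l2Inner ι (S a) (S u) =
      ∑ k ∈ F, (η k)⁻¹ * (inner ℝ (φ k) v * inner ℝ (φ k) u) := fun u => by
    change l2InnerLeft hΩo hΩb ι (S u) (S a) = _
    rw [ha, map_sum, map_sum]
    refine Finset.sum_congr rfl fun k _ => ?_
    rw [map_smul, map_smul, smul_eq_mul]
    change _ * l2Inner ι (S (φ k)) (S u) = _
    rw [hE]; ring
  have horth : ∀ k ∈ F, inner ℝ (φ k) (v - a) = 0 := fun k hk => by
    rw [inner_sub_right, ha, φ.orthonormal.inner_right_sum _ hk, sub_self]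
  -- The eigenrelation transfers the `X`-orthogonality of `v - a` to `L²(Ω)`, so Pythagoras applies
  -- to `S v`.
  have h1 : l2Inner ι (S a) (S (v - a)) = 0 := by
    rw [hl]
    exact Finset.sum_eq_zero fun k hk => by rw [horth k hk, mul_zero, mul_zero]
  have hsub : ∀ w, l2Inner ι (S (v - a)) w = l2Inner ι (S v) w - l2Inner ι (S a) w := fun w => by
    rw [map_sub]; exact map_sub (l2InnerLeft hΩo hΩb ι w) _ _
  have h2 := l2Inner_self_nonneg ι (S (v - a))
  rw [hsub, h1, sub_zero, l2Inner_comm, hsub, hl] at h2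
  simp only [← sq] at h2
  linarith

/-- Cauchy–Schwarz twice: weights `η_k^{∓1/2}` separate `v` from `g`, then `∑ η_k^{-1/2} v_k²` is
bounded by the geometric mean of `∑ v_k²` and `∑ η_k^{-1} v_k²`, both controlled by Bessel. Partial
sums of the Parseval series suffice. -/
theorem IsEigenBasis.dualNormZ_le (hΩo : IsOpen Ω) (hΩb : Bornology.IsBounded Ω)
    {ι : Y →L[ℝ] (closure Ω →ᵇ ℝ)} {S : X →L[ℝ] Y} {η : ℕ → ℝ} {φ : HilbertBasis ℕ ℝ X}
    (h : IsEigenBasis ι S η φ) {v : X} {a b : ℝ} (hb : 0 ≤ b) (hva : ‖v‖ ≤ a)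
    (hvb : l2Inner ι (S v) (S v) ≤ b ^ 2) :
    dualNormZ η φ v ≤ ENNReal.ofReal √(a * b) := by
  have ha : 0 ≤ a := (norm_nonneg v).trans hva
  refine iSup_le fun g => iSup_le fun hg => iSup_le fun _ => ENNReal.ofReal_le_ofReal ?_
  have hsum : Summable fun k => (η k) ^ (1 / 2 : ℝ) * (inner ℝ g (φ k)) ^ 2 := hg
  refine div_le_of_le_mul₀ (Real.sqrt_nonneg _) (Real.sqrt_nonneg _) ?_
  have hroot : ∀ k, 0 < η k ^ (1 / 2 : ℝ) := fun k => Real.rpow_pos_of_pos (h.pos k) _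
  have hrr : ∀ k, η k ^ (1 / 2 : ℝ) * η k ^ (1 / 2 : ℝ) = η k := fun k => by
    rw [← Real.rpow_add (h.pos k)]; norm_num
  refine le_of_tendsto' (φ.hasSum_inner_mul_inner v g).abs fun F => ?_
  refine abs_le_of_sq_le_sq ?_ (mul_nonneg (Real.sqrt_nonneg _) (Real.sqrt_nonneg _))
  rw [mul_pow, Real.sq_sqrt (mul_nonneg ha hb), normZ,
    Real.sq_sqrt (tsum_nonneg fun k => mul_nonneg (hroot k).le (sq_nonneg _))]
  have h1 : (∑ k ∈ F, (η k ^ (1 / 2 : ℝ))⁻¹ * inner ℝ (φ k) v ^ 2) ≤ a * b := by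
    refine (abs_le_of_sq_le_sq' ?_ (mul_nonneg ha hb)).2
    have h2 := φ.orthonormal.sum_inner_products_le (s := F) (x := v)
    simp only [Real.norm_eq_abs, sq_abs] at h2
    calc _ ≤ (∑ k ∈ F, inner ℝ (φ k) v ^ 2) * ∑ k ∈ F, (η k)⁻¹ * inner ℝ (φ k) v ^ 2 := by
          refine Finset.sum_sq_le_sum_mul_sum_of_sq_le_mul _ (fun k _ => sq_nonneg _)
            (fun k _ => mul_nonneg (inv_nonneg.2 (h.pos k).le) (sq_nonneg _)) fun k _ => le_of_eq ?_
          rw [mul_pow, ← hrr k, mul_inv]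
          simp only [hrr]; ring
      _ ≤ a ^ 2 * b ^ 2 := mul_le_mul (h2.trans (pow_le_pow_left₀ (norm_nonneg v) hva 2))
          ((h.sum_inv_mul_inner_sq_le hΩo hΩb v F).trans hvb)
          (Finset.sum_nonneg fun k _ => mul_nonneg (inv_nonneg.2 (h.pos k).le) (sq_nonneg _))
          (sq_nonneg a)
      _ = _ := by ring
  have h3 : (∑ k ∈ F, η k ^ (1 / 2 : ℝ) * inner ℝ g (φ k) ^ 2) ≤
      ∑' k, η k ^ (1 / 2 : ℝ) * inner ℝ g (φ k) ^ 2 :=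
    hsum.sum_le_tsum F fun k _ => mul_nonneg (hroot k).le (sq_nonneg _)
  calc _ ≤ (∑ k ∈ F, (η k ^ (1 / 2 : ℝ))⁻¹ * inner ℝ (φ k) v ^ 2) *
        ∑ k ∈ F, η k ^ (1 / 2 : ℝ) * inner ℝ g (φ k) ^ 2 := by
        refine Finset.sum_sq_le_sum_mul_sum_of_sq_le_mul _
          (fun k _ => mul_nonneg (inv_nonneg.2 (hroot k).le) (sq_nonneg _))
          (fun k _ => mul_nonneg (hroot k).le (sq_nonneg _)) fun k _ => le_of_eq ?_
        rw [real_inner_comm v, real_inner_comm (φ k) g]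
        have := (hroot k).ne'
        field_simp
    _ ≤ _ := mul_le_mul h1 h3 (Finset.sum_nonneg fun k _ =>
        mul_nonneg (hroot k).le (sq_nonneg _)) (mul_nonneg ha hb)

end DualNorm


/-- A tail bound `B exp (-c z²)` valid for large `z` only, after a rescaling, gives the bound
`2 exp (-C z²)` for all `z`, since probabilities are at most one. -/
theorem exists_tail_const {B z₀ M : ℝ} (hB : 0 < B) (hz₀ : 1 ≤ z₀) (hM : 0 < M) :
    ∃ C Z : ℝ, 0 < C ∧ z₀ ≤ Z ∧ ∀ z : ℝ, 0 < z →
      (z < 2 * M * Z → 1 ≤ 2 * Real.exp (-C * z ^ 2)) ∧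
      (Z ≤ z / (2 * M) → B * Real.exp (-(z / (2 * M)) ^ 2 / 8) ≤ 2 * Real.exp (-C * z ^ 2)) := by
  -- With `w ≥ 16 B` and `w ≥ 1`, the inequality `exp t ≥ 1 + t` lets half of the exponent `w²/8`
  -- absorb `B`.
  set Z : ℝ := z₀ + 16 * B with hZ
  have hZ0 : 0 < Z := by positivity
  have hl : 0 < Real.log 2 := Real.log_pos one_lt_two
  refine ⟨min (Real.log 2 / (2 * M * Z) ^ 2) (1 / (16 * (2 * M) ^ 2)), Z,
    lt_min (by positivity) (by positivity), by linarith, fun z hz => ⟨fun h => ?_, fun h => ?_⟩⟩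
  · have h1 : min (Real.log 2 / (2 * M * Z) ^ 2) (1 / (16 * (2 * M) ^ 2)) * z ^ 2 ≤ Real.log 2 :=
      calc _ ≤ Real.log 2 / (2 * M * Z) ^ 2 * (2 * M * Z) ^ 2 := by
            gcongr
            exact min_le_left _ _
        _ = Real.log 2 := by field_simp
    rw [neg_mul]
    calc (1 : ℝ) = 2 * Real.exp (-Real.log 2) := by
          rw [Real.exp_neg, Real.exp_log two_pos]; norm_num
      _ ≤ _ := by gcongr
  · set w := z / (2 * M) with hw
    have hwz : z = 2 * M * w := by rw [hw]; field_simp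
    have h1 : min (Real.log 2 / (2 * M * Z) ^ 2) (1 / (16 * (2 * M) ^ 2)) * z ^ 2 ≤ w ^ 2 / 16 :=
      calc _ ≤ 1 / (16 * (2 * M) ^ 2) * z ^ 2 := by
            gcongr
            exact min_le_right _ _
        _ = w ^ 2 / 16 := by rw [hwz]; field_simp
    have h2 : B ≤ 2 * Real.exp (w ^ 2 / 16) := by
      have h3 : w ^ 2 / 16 + 1 ≤ Real.exp (w ^ 2 / 16) := Real.add_one_le_exp _
      have h4 : 16 * B ≤ w := by linarith
      nlinarith
    calc B * Real.exp (-w ^ 2 / 8) ≤ 2 * Real.exp (w ^ 2 / 16) * Real.exp (-w ^ 2 / 8) := by gcongr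
      _ = 2 * Real.exp (-(w ^ 2 / 16)) := by
          rw [mul_assoc, ← Real.exp_add]; congr 2; ring
      _ ≤ _ := by rw [neg_mul]; gcongr

/-! ### The consistency error under noise, and the passage from the empirical norm to `L²(Ω)`. -/

section Discretization

variable {d : ℕ} {Ω : Set (Space d)} {X Y : Type*}
  [NormedAddCommGroup X] [InnerProductSpace ℝ X]
  [NormedAddCommGroup Y] [InnerProductSpace ℝ Y]

theorem Discretization.measure_consistency_error_le (D : Discretization X Y)
    (ι : Y →L[ℝ] (closure Ω →ᵇ ℝ)) (S : X →L[ℝ] Y) {n : ℕ} (hn : 0 < n) (x : Fin n → Ω)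
    {𝔛 : Type*} [MeasurableSpace 𝔛] {P : Measure 𝔛} [IsProbabilityMeasure P]
    {σ : ℝ} (hσ : 0 < σ) {e : Fin n → 𝔛 → ℝ} (he : IsSubGaussianNoise P σ e) {z : ℝ}
    (hz : 0 ≤ z) :
    P {ω | ¬ ∀ g ∈ D.Vh, |empInner (fun i => e i ω) (sample ι x (S g - D.Sh g))| ≤
        σ * (n : ℝ) ^ (-1 / 2 : ℝ) * z * √(D.dimVh : ℝ) * empNorm (sample ι x (S g - D.Sh g))}
      ≤ ENNReal.ofReal (expSqConst.toReal * Real.exp (-z ^ 2 / 8)) := by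
  have := D.finite_Vh
  let T : X →ₗ[ℝ] EuclideanSpace ℝ (Fin n) :=
    (WithLp.linearEquiv 2 ℝ (Fin n → ℝ)).symm.toLinearMap ∘ₗ evalAt x ∘ₗ
      (ι : Y →ₗ[ℝ] (closure Ω →ᵇ ℝ)) ∘ₗ ((S : X →ₗ[ℝ] Y) - D.Sh)
  have h := he.measure_exists_lt_abs_empInner_le hn hσ (D.Vh.map T) (N := D.dimVh)
    (Submodule.finrank_map_le T D.Vh) hz
  rw [ENNReal.ofReal_mul ENNReal.toReal_nonneg, ENNReal.ofReal_toReal expSqConst_ne_top]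
  refine (measure_mono fun ω hω => ?_).trans h
  rw [Set.mem_ofPred_eq] at hω
  push Not at hω
  obtain ⟨g, hg, hlt⟩ := hω
  exact ⟨T g, Submodule.mem_map_of_mem hg, hlt⟩

/-- Since `n^{-β} ≤ μ²`, the `Y`-norm term of the comparison is of the same order `(μ t)²` as the
empirical term. -/
theorem l2Inner_le_of_normComparison {ι : Y →L[ℝ] (closure Ω →ᵇ ℝ)} {n : ℕ} {x : Fin n → Ω}
    {β C₁ : ℝ} (h : NormComparison ι x β C₁) (hC₁ : 0 < C₁) (S : X →L[ℝ] Y) {μ : ℝ}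
    (hn : (n : ℝ) ^ (-β) ≤ μ ^ 2) {v : X} {t : ℝ} (hv : ‖v‖ ≤ t)
    (hSv : empNorm (sample ι x (S v)) ≤ μ * t) :
    l2Inner ι (S v) (S v) ≤ (√(C₁ * (1 + ‖S‖ ^ 2)) * (μ * t)) ^ 2 := by
  refine (h (S v)).1.trans ?_
  rw [mul_pow, Real.sq_sqrt (by positivity), mul_assoc]
  refine mul_le_mul_of_nonneg_left ?_ hC₁.le
  have h1 : ‖S v‖ ≤ ‖S‖ * t := (S.le_opNorm v).trans (by gcongr)
  have h2 : empNorm (sample ι x (S v)) ^ 2 ≤ (μ * t) ^ 2 :=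
    pow_le_pow_left₀ (empNorm_nonneg _) hSv 2
  have h3 : (n : ℝ) ^ (-β) * ‖S v‖ ^ 2 ≤ μ ^ 2 * (‖S‖ * t) ^ 2 := by gcongr
  calc _ ≤ (μ * t) ^ 2 + μ ^ 2 * (‖S‖ * t) ^ 2 := add_le_add h2 h3
    _ = _ := by ring

end Discretization

end InverseSource

/-! ### Assembly: one exceptional event for all three estimates. -/

theorem mainTheorem4 {d : ℕ} {Ω : Set (Space d)}
    (hΩo : IsOpen Ω) (hΩc : IsConnected Ω) (hΩb : Bornology.IsBounded Ω)
    {X Y : Type*}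
    [NormedAddCommGroup X] [InnerProductSpace ℝ X] [CompleteSpace X]
    [NormedAddCommGroup Y] [InnerProductSpace ℝ Y] [CompleteSpace Y]
    (ι : Y →L[ℝ] (closure Ω →ᵇ ℝ)) (hι : IsObservationEmbedding ι)
    (S : X →L[ℝ] Y)
    (γ C₂ : ℝ) (hγ : γ < 2) (hC₂ : 0 < C₂) (hentropy : CoveringEntropyBound ι γ C₂)
    -- the constants in the other assumptions
    (C₃ C₄ C₅ : ℝ) (hC₃ : 0 < C₃) (hC₄ : 0 < C₄) (hC₅ : 0 < C₅)
    (α β C₁ c₁ : ℝ) (hα : 1 < α) (hαβ : α ≤ β) (hC₁ : 0 < C₁) (hc₁ : 0 < c₁) :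
    ∃ C : ℝ, 0 < C ∧
      ∀ {n : ℕ} (_ : 0 < n) (x : Fin n → Ω)
        {𝔛 : Type*} [MeasurableSpace 𝔛] (P : Measure 𝔛) [IsProbabilityMeasure P]
        (σ : ℝ) (_ : 0 < σ) (e : Fin n → 𝔛 → ℝ) (_ : IsSubGaussianNoise P σ e)
        (fstar : X) (ρ₀ : ℝ) (_ : ρ₀ = ‖fstar‖ + σ * (n : ℝ) ^ (-1 / 2 : ℝ))
        (D : Discretization X Y) (lam eh : ℝ) (_ : 0 < lam) (_ : 0 ≤ eh)
        (_ : D.Approximates ι S x lam eh C₃)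
        (_ : eh ≤ C₄ * lam) (_ : (D.dimVh : ℝ) * eh ≤ C₄ * lam ^ (1 - γ / 2))
        (_ : σ * (n : ℝ) ^ (-1 / 2 : ℝ) * ρ₀⁻¹ ≤ C₅ * lam ^ (1 / 2 + γ / 4))
        (fh : 𝔛 → X)
        (_ : ∀ ω, D.IsSolution ι x lam (fun i => sample ι x (S fstar) i + e i ω) (fh ω)),
        (∀ z : ℝ, 0 < z →
          P {ω | lam ^ (1 / 2 : ℝ) * ρ₀ * z
              ≤ empNorm (sample ι x (D.Sh (fh ω) - S fstar))}
            ≤ ENNReal.ofReal (2 * Real.exp (-C * z ^ 2)) ∧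
          P {ω | ρ₀ * z ≤ ‖fh ω‖} ≤ ENNReal.ofReal (2 * Real.exp (-C * z ^ 2))) ∧
        (∀ (η : ℕ → ℝ) (φ : HilbertBasis ℕ ℝ X), IsEigenBasis ι S η φ →
          NormComparison ι x β C₁ →
          (∀ k < n, c₁ * ((k : ℝ) + 1) ^ α ≤ η k) →
          (n : ℝ) ^ (-β) ≤ lam →
          ∀ z : ℝ, 0 < z →
            P {ω | ENNReal.ofReal (lam ^ (1 / 4 : ℝ) * ρ₀ * z) ≤ dualNormZ η φ (fh ω - fstar)}
              ≤ ENNReal.ofReal (2 * Real.exp (-C * z ^ 2))) := by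
  obtain ⟨K, B, z₀, hK, hB, hz₀, hmax⟩ :=
    exists_maximal_inequality ι hι.injective hγ hC₂ hentropy
  obtain ⟨M, hM, herr⟩ := exists_error_bound (Ω := Ω) S γ C₃ C₄ C₅ K hC₃ hC₄ hC₅ hK
  set κ : ℝ := √(C₁ * (1 + ‖S‖ ^ 2)) with hκ
  -- Dominates both `M` and the constant `M √κ` of the `Z'` estimate, so a single `C` serves all
  -- three tails.
  set M' : ℝ := M + M * √κ with hM'
  have hM'0 : 0 < M' := by positivity
  obtain ⟨C, Z, hC, hZ, htail⟩ := exists_tail_const (B := B + expSqConst.toReal) (by positivity)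
    hz₀ hM'0
  refine ⟨C, hC, ?_⟩
  intro n hn x 𝔛 _ P _ σ hσ e he fstar ρ₀ hρ₀ D lam eh hlam heh happ heh1 heh2 hs fh hsol
  have hn' : (0 : ℝ) < n := Nat.cast_pos.2 hn
  set s : ℝ := σ * (n : ℝ) ^ (-1 / 2 : ℝ) with hsdef
  have hs0 : 0 < s := by positivity
  have hρ : 0 < ρ₀ := by rw [hρ₀]; positivity
  have hfρ : ‖fstar‖ ≤ ρ₀ := by rw [hρ₀]; linarith
  set μ : ℝ := √lam with hμ
  have hμ0 : 0 < μ := Real.sqrt_pos.2 hlam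
  have hμ2 : μ ^ 2 = lam := Real.sq_sqrt hlam.le
  have hpow : ∀ p : ℝ, lam ^ p = μ ^ (2 * p) := fun p => by
    rw [← hμ2, ← Real.rpow_natCast, ← Real.rpow_mul hμ0.le]; norm_num
  have hhalf : lam ^ (1 / 2 : ℝ) = μ := (Real.sqrt_eq_rpow lam).symm
  have hquarter : lam ^ (1 / 4 : ℝ) = √μ := by
    rw [hpow, Real.sqrt_eq_rpow]; norm_num
  rw [hpow, show 2 * (1 - γ / 2) = 2 - γ by ring] at heh2
  rw [hpow, show 2 * (1 / 2 + γ / 4) = 1 + γ / 2 by ring, ← div_eq_mul_inv, div_le_iff₀ hρ] at hs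
  rw [← hμ2] at happ heh1 hsol
  -- the exceptional event at level `z`, and the three error bounds outside of it
  let A : ℝ → Set 𝔛 := fun z =>
    {ω | ¬ ∀ (u : Y) (r R : ℝ), 0 < r → 0 < R → empNorm (sample ι x u) ≤ r → ‖u‖ ≤ R →
        |empInner (fun i => e i ω) (sample ι x u)|
          ≤ K * s * z * (r ^ (1 - γ / 2) * R ^ (γ / 2))} ∪
    {ω | ¬ ∀ g ∈ D.Vh, |empInner (fun i => e i ω) (sample ι x (S g - D.Sh g))| ≤
        s * z * √(D.dimVh : ℝ) * empNorm (sample ι x (S g - D.Sh g))}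
  have hA : ∀ z, Z ≤ z →
      P (A z) ≤ ENNReal.ofReal ((B + expSqConst.toReal) * Real.exp (-z ^ 2 / 8)) := by
    intro z hz
    have hz0 : 0 ≤ z := by linarith
    refine (measure_union_le _ _).trans ((add_le_add (hmax hn x P σ hσ e he z (hZ.trans hz))
      (D.measure_consistency_error_le ι S hn x hσ he hz0)).trans ?_)
    rw [← ENNReal.ofReal_add (by positivity) (by positivity), add_mul]
    refine ENNReal.ofReal_le_ofReal (add_le_add_left ?_ _)
    gcongr B * Real.exp ?_
    nlinarith [sq_nonneg z]
  have hgood : ∀ z, Z ≤ z → ∀ ω, ω ∉ A z →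
      empNorm (sample ι x (D.Sh (fh ω) - S fstar)) ≤ M * (μ * ρ₀ * z) ∧ ‖fh ω‖ ≤ M * (ρ₀ * z) ∧
      ‖fh ω - fstar‖ ≤ M * (ρ₀ * z) ∧
      empNorm (sample ι x (S (fh ω - fstar))) ≤ M * (μ * ρ₀ * z) := by
    intro z hz ω hω
    have hz1 : 1 ≤ z := hz₀.trans (hZ.trans hz)
    exact herr ι x D μ eh s ρ₀ z fstar (fh ω) (fun i => e i ω) hμ0 heh hs0.le hρ hz1 hfρ happ heh1
      heh2 hs (not_not.1 fun h => hω (Or.inl h)) (not_not.1 fun h => hω (Or.inr h)) (hsol ω)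
  have hprob : ∀ (Q : Set 𝔛) (z : ℝ), 0 < z → (Z ≤ z / (2 * M') → Q ⊆ A (z / (2 * M'))) →
      P Q ≤ ENNReal.ofReal (2 * Real.exp (-C * z ^ 2)) := by
    intro Q z hz hQ
    rcases lt_or_ge z (2 * M' * Z) with hlt | hge
    · refine prob_le_one.trans ?_
      rw [← ENNReal.ofReal_one]
      exact ENNReal.ofReal_le_ofReal ((htail z hz).1 hlt)
    · have hZz : Z ≤ z / (2 * M') := by
        rw [le_div_iff₀ (by positivity), mul_comm]; exact hge
      exact (measure_mono (hQ hZz)).trans ((hA _ hZz).trans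
        (ENNReal.ofReal_le_ofReal ((htail z hz).2 hZz)))
  -- The noise level is `z / (2 M')` rather than `z / M'`: the spare factor `2` gives the strict
  -- inequality that contradicts the non-strict events.
  have hlt : ∀ L t z : ℝ, L ≤ M' → 0 < t → 0 < z → L * (t * (z / (2 * M'))) < t * z := by
    intro L t z hL ht hz
    have h1 : M' * (t * (z / (2 * M'))) = t * z / 2 := by field_simp
    have h2 : L * (t * (z / (2 * M'))) ≤ M' * (t * (z / (2 * M'))) := by gcongr
    have h3 : 0 < t * z := by positivity
    linarith
  have hMM' : M ≤ M' := le_add_of_nonneg_right (by positivity)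
  refine ⟨fun z hz => ⟨?_, ?_⟩, ?_⟩
  · refine hprob _ z hz fun hZz ω hω => ?_
    by_contra hωA
    rw [Set.mem_ofPred_eq, hhalf] at hω
    exact (hω.trans (hgood _ hZz ω hωA).1).not_gt (hlt M _ z hMM' (by positivity) hz)
  · refine hprob _ z hz fun hZz ω hω => ?_
    by_contra hωA
    exact (hω.trans (hgood _ hZz ω hωA).2.1).not_gt (hlt M _ z hMM' hρ hz)
  · intro η φ hφ hcomp _ hnβ z hz
    refine hprob _ z hz fun hZz ω hω => ?_
    by_contra hωA
    obtain ⟨-, -, h1, h2⟩ := hgood _ hZz ω hωA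
    set w := z / (2 * M') with hw
    have hw0 : 0 < w := by positivity
    have h3 : M * (μ * ρ₀ * w) = μ * (M * (ρ₀ * w)) := by ring
    rw [h3] at h2
    have h4 := hφ.dualNormZ_le hΩo hΩb (by positivity) h1 (l2Inner_le_of_normComparison hcomp hC₁ S
      (hnβ.trans_eq hμ2.symm) h1 h2)
    have h5 : √(M * (ρ₀ * w) * (κ * (μ * (M * (ρ₀ * w))))) = (M * √κ) * (√μ * ρ₀ * w) := by
      rw [show M * (ρ₀ * w) * (κ * (μ * (M * (ρ₀ * w)))) = κ * μ * (M * (ρ₀ * w)) ^ 2 by ring,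
        Real.sqrt_mul (by positivity), Real.sqrt_mul (by positivity), Real.sqrt_sq (by positivity)]
      ring
    rw [Set.mem_ofPred_eq, hquarter] at hω
    rw [h5] at h4
    have h6 := hω.trans h4
    rw [ENNReal.ofReal_le_ofReal_iff (by positivity)] at h6
    exact h6.not_gt (hlt _ _ z (le_add_of_nonneg_left hM.le) (by positivity) hz)
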